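/- Let $d\ge 1$, let $K\subset\mathbb R^d$ be a convex body (compact, convex, with non-empty interior), and let $\lambda_1,\lambda_2,\dots>0$ be real numbers with $\sum_{i=1}^\infty\lambda_i^d=\infty$. For a countable arrangement $\mathcal A=(A_i)$ of compact sets let $$d_-(\mathcal A)=\liminf_{r\to\infty}\frac{1}{\operatorname{vol}(B_r)}\sum_{A_i\subseteq B_r}\operatorname{vol}(A_i),\qquad d_+(\mathcal A)=\limsup_{r\to\infty}\frac{1}{\operatorname{vol}(B_r)}\sum_{A_i\cap B_r\ne\emptyset}\operatorname{vol}(A_i),$$ where $B_r$ is the closed Euclidean ball of radius $r$ about the origin; $\mathcal A$ has density $\delta$ if $d_-(\mathcal A)=d_+(\mathcal A)=\delta$. Let $\vartheta(K)$ be the infimum of $d_-(\mathcal A)$ over all coverings $\mathcal A$ of $\mathbb R^d$ by translates of $K$. A limit point of the sequence $(\lambda_i)$ is a real number $c$ such that every neighbourhood of $c$ contains $\lambda_i$ for infinitely many indices $i$. (a) If $(\lambda_i)$ is bounded and has a limit point other than $0$, then there are $x_1,x_2,\dots\in\mathbb R^d$ such that the sets $x_i+\lambda_iK$ $(i\ge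 1)$ cover $\mathbb R^d$ and have density $\vartheta(K)$. (b) If $(\lambda_i)$ is bounded and has no limit point other than $0$, then there are $x_1,x_2,\dots\in\mathbb R^d$ such that the sets $x_i+\lambda_iK$ $(i\ge 1)$ cover $\mathbb R^d$ and have density $1$. (c) If $(\lambda_i)$ is unbounded, then there are $x_1,x_2,\dots\in\mathbb R^d$ such that the sets $x_i+\lambda_iK$ $(i\ge 1)$ cover $\mathbb R^d$ and every point of $\mathbb R^d$ belongs to $x_i+\lambda_iK$ for at most $4d$ indices $i$. -/

import Mathlib

open MeasureTheory Filter Topology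
open scoped Pointwise ENNReal

namespace TranslativeCovering

variable {d : ℕ} {ι : Type*}

/-- The density of the arrangement `A` in the window `G`, counting the members contained in `G`. -/
noncomputable def innerDensity (A : ι → Set (EuclideanSpace ℝ (Fin d)))
    (G : Set (EuclideanSpace ℝ (Fin d))) : ℝ≥0∞ :=
  (∑' i : {i : ι // A i ⊆ G}, volume (A i)) / volume G

/-- The density of the arrangement `A` in the window `G`, counting the members that meet `G`. -/
noncomputable def outerDensity (A : ι → Set (EuclideanSpace ℝ (Fin d)))
    (G : Set (EuclideanSpace ℝ (Fin d))) : ℝ≥0∞ :=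
  (∑' i : {i : ι // (A i ∩ G).Nonempty}, volume (A i)) / volume G

/-- Lower density of an arrangement: `liminf` of the inner densities in large balls. -/
noncomputable def lowerDensity (A : ι → Set (EuclideanSpace ℝ (Fin d))) : ℝ≥0∞ :=
  liminf (fun r : ℝ => innerDensity A (Metric.closedBall 0 r)) atTop

/-- Upper density of an arrangement: `limsup` of the outer densities in large balls. -/
noncomputable def upperDensity (A : ι → Set (EuclideanSpace ℝ (Fin d))) : ℝ≥0∞ :=
  limsup (fun r : ℝ => outerDensity A (Metric.closedBall 0 r)) atTop

/-- The arrangement `A` has density `δ`: its lower and upper densities both equal `δ`. -/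
def HasDensity (A : ι → Set (EuclideanSpace ℝ (Fin d))) (δ : ℝ≥0∞) : Prop :=
  lowerDensity A = δ ∧ upperDensity A = δ

/-- The arrangement `A` covers the whole space. -/
def CoversSpace (A : ι → Set (EuclideanSpace ℝ (Fin d))) : Prop :=
  ⋃ i, A i = Set.univ

/-- The translative covering density of `K`: the infimum of the lower densities of the coverings
of the space by translates `t + K`, `t ∈ T`. -/
noncomputable def coveringDensity (K : Set (EuclideanSpace ℝ (Fin d))) : ℝ≥0∞ :=
  ⨅ (T : Set (EuclideanSpace ℝ (Fin d))) (_ : CoversSpace (fun t : T => t.1 +ᵥ K)),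
    lowerDensity (fun t : T => t.1 +ᵥ K)

/-- The family `F` permits a translative covering of the space with density `δ`: one can choose
a translation vector for every member of `F` so that the translates cover the space, with
density `δ`. -/
def PermitsCoveringOfDensity (F : ι → Set (EuclideanSpace ℝ (Fin d))) (δ : ℝ≥0∞) : Prop :=
  ∃ x : ι → EuclideanSpace ℝ (Fin d),
    CoversSpace (fun i => x i +ᵥ F i) ∧ HasDensity (fun i => x i +ᵥ F i) δ

/-- The family `F` permits a translative covering of the space (using every member of `F`) in
which no point is covered by more than `m` of the translates. -/
def PermitsCoveringOfMultiplicity (F : ι → Set (EuclideanSpace ℝ (Fin d))) (m : ℕ) : Prop :=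
  ∃ x : ι → EuclideanSpace ℝ (Fin d),
    CoversSpace (fun i => x i +ᵥ F i) ∧ ∀ p, {i | p ∈ x i +ᵥ F i}.encard ≤ (m : ℕ∞)

end TranslativeCovering

/-! Parts (a) and (b) reduce to coverings of cubes. Suppose that every cube of side s can be covered
by bodies avoiding any prescribed finite set of indices, with total volume between (δ-ε)s^d and
(δ+ε)(s+D)^d, where D depends on neither ε nor s (`HasCubeCoverings`). Tile the space by cubes of
side 2^n at distance of order 4^n from the origin, so that the sides tend to infinity but are
negligible against the distance. Cover the tiles one after the other with fresh bodies and ε → 0,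
adding body k at tile k if it is still unused; since the sequence is bounded, the added volume is
negligible. Each tile then carries volume (δ+o(1)) times its own, and because tiles and bodies are
small compared with their distance from the origin, this gives density δ
(`IsSlowPacking.upperDensity_le`, `IsSlowPacking.le_lowerDensity`).

For (a), infinitely many ratios lie between c(1-η) and c(1+η) for some c > 0. Shrinking these bodies
to ratio c(1-η) turns economical coverings by congruent copies into coverings by the given bodies.
Enlarging them to ratio c(1+η) shows that no covering can beat the covering density, since a covered
cube extends to a periodic covering of the space.

For (b), the ratios tend to 0. Inscribed cubes, rounded down to dyadic fractions of s, cover the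
cube of side s at some cost c per unit of volume. If c > 1 the cost can be lowered: dissect the cube
into dyadic cells, each holding a body that fills at least a fixed fraction f of it, and cover the
compact remainders at cost c. The new cost is about c - (c-1)f, so the infimum of the costs is 1.

For (c), a very large homothet of a body that contains a ball touching a supporting hyperplane looks
locally like a half-space. By Steinitz' theorem, 2d such half-spaces suffice to cover the complement
of a ball while avoiding a smaller ball, so 2d large bodies cover an annulus
(`exists_annulus_covering`). The annuli are taken so far apart that a point meets the bodies of at
most two consecutive stages, which gives 4d; each remaining body is placed outside everything used
so far. -/

namespace TranslativeCovering

/-! ### Cubes, grids and homothets -/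

section

variable {d : ℕ}

/-- The Euclidean space of dimension `d`. -/
abbrev Space (d : ℕ) := EuclideanSpace ℝ (Fin d)

/-- The half-open axis-parallel cube with lowest corner `p` and side `s`. -/
def cube (p : Space d) (s : ℝ) : Set (Space d) := {x | ∀ j, p j ≤ x j ∧ x j < p j + s}

theorem cube_eq_preimage (p : Space d) (s : ℝ) :
    cube p s = (fun x : Space d => WithLp.ofLp x) ⁻¹'
      (Set.univ.pi fun j => Set.Ico (p j) (p j + s)) := by
  ext x
  simp [cube, Set.mem_pi]

theorem measurableSet_cube (p : Space d) (s : ℝ) : MeasurableSet (cube p s) := by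
  rw [cube_eq_preimage]
  exact (PiLp.volume_preserving_ofLp (Fin d)).measurable
    (MeasurableSet.univ_pi fun j => measurableSet_Ico)

theorem volume_cube (p : Space d) (s : ℝ) : volume (cube p s) = ENNReal.ofReal s ^ d := by
  rw [cube_eq_preimage, (PiLp.volume_preserving_ofLp (Fin d)).measure_preimage
    (MeasurableSet.univ_pi fun j => measurableSet_Ico).nullMeasurableSet, volume_pi_pi]
  simp

theorem volume_cube' (p : Space d) {s : ℝ} (hs : 0 ≤ s) :
    volume (cube p s) = ENNReal.ofReal (s ^ d) := by
  rw [volume_cube, ENNReal.ofReal_pow hs]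

theorem norm_le_of_coord_le {x : Space d} {s : ℝ} (hs : 0 ≤ s) (h : ∀ j, |x j| ≤ s) :
    ‖x‖ ≤ d * s := by
  rw [EuclideanSpace.norm_eq]
  apply Real.sqrt_le_iff.2 ⟨by positivity, ?_⟩
  calc ∑ i, ‖x i‖ ^ 2 ≤ ∑ _i : Fin d, s ^ 2 := by
        gcongr with i
        exact h i
    _ = d * s ^ 2 := by simp
    _ ≤ (d * s) ^ 2 := by
        have : (d : ℝ) ≤ (d : ℝ) ^ 2 := by
          exact_mod_cast Nat.le_self_pow two_ne_zero d
        nlinarith [sq_nonneg s]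

theorem abs_coord_le_norm (x : Space d) (j : Fin d) : |x j| ≤ ‖x‖ := by
  simpa using PiLp.norm_apply_le x j

theorem cube_subset_closedBall (p : Space d) {s : ℝ} (hs : 0 ≤ s) :
    cube p s ⊆ Metric.closedBall p (d * s) := by
  intro x hx
  rw [Metric.mem_closedBall, dist_eq_norm]
  apply norm_le_of_coord_le hs
  intro j
  have := hx j
  rw [PiLp.sub_apply, abs_le]
  constructor <;> linarith [this.1, this.2]

theorem self_mem_cube (p : Space d) {s : ℝ} (hs : 0 < s) : p ∈ cube p s := by
  intro j
  constructor <;> linarith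

theorem cube_mono (p : Space d) {s t : ℝ} (hst : s ≤ t) : cube p s ⊆ cube p t := by
  intro x hx j
  exact ⟨(hx j).1, by linarith [(hx j).2]⟩

theorem vadd_cube (v p : Space d) (s : ℝ) : v +ᵥ cube p s = cube (v + p) s := by
  ext x
  rw [Set.mem_vadd_set_iff_neg_vadd_mem]
  simp only [cube, Set.mem_ofPred_eq, vadd_eq_add, PiLp.add_apply, PiLp.neg_apply]
  refine forall_congr' fun j => ?_
  constructor <;> rintro ⟨h1, h2⟩ <;> constructor <;> linarith

theorem smul_cube (p : Space d) (s : ℝ) {c : ℝ} (hc : 0 < c) :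
    c • cube p s = cube (c • p) (c * s) := by
  ext x
  rw [Set.mem_smul_set_iff_inv_smul_mem₀ hc.ne']
  simp only [cube, Set.mem_ofPred_eq, PiLp.smul_apply, smul_eq_mul]
  refine forall_congr' fun j => ?_
  rw [← mul_add, le_inv_mul_iff₀ hc, inv_mul_lt_iff₀ hc]


/-- The corner `h z` of a cell of the cubical grid of width `h`. -/
noncomputable def corner (h : ℝ) (z : Fin d → ℤ) : Space d := WithLp.toLp 2 fun j => h * z j

@[simp] theorem corner_apply (h : ℝ) (z : Fin d → ℤ) (j : Fin d) : corner h z j = h * z j := rfl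

/-- A cell of the cubical grid of width `h`. -/
noncomputable def cell (h : ℝ) (z : Fin d → ℤ) : Set (Space d) := cube (corner h z) h

theorem mem_cell {h : ℝ} (hh : 0 < h) {z : Fin d → ℤ} {x : Space d} :
    x ∈ cell h z ↔ ∀ j, ⌊x j / h⌋ = z j := by
  simp only [cell, cube, Set.mem_ofPred_eq, corner_apply, Int.floor_eq_iff]
  refine forall_congr' fun j => ?_
  rw [le_div_iff₀ hh, div_lt_iff₀ hh]
  constructor <;> rintro ⟨h1, h2⟩ <;> constructor <;> linarith

theorem mem_cell_floor {h : ℝ} (hh : 0 < h) (x : Space d) :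
    x ∈ cell h (fun j => ⌊x j / h⌋) := (mem_cell hh).2 fun _ => rfl

theorem cell_unique {h : ℝ} (hh : 0 < h) {z w : Fin d → ℤ} {x : Space d}
    (hz : x ∈ cell h z) (hw : x ∈ cell h w) : z = w := by
  ext j
  rw [← (mem_cell hh).1 hz j, (mem_cell hh).1 hw j]

theorem pairwise_disjoint_cell {h : ℝ} (hh : 0 < h) :
    Pairwise (Function.onFun Disjoint (cell h : (Fin d → ℤ) → Set (Space d))) := by
  intro z w hzw
  rw [Function.onFun, Set.disjoint_left]
  intro x hz hw
  exact hzw (cell_unique hh hz hw)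

theorem finite_norm_corner_le {h : ℝ} (hh : 0 < h) (R : ℝ) :
    {z : Fin d → ℤ | ‖corner h z‖ ≤ R}.Finite := by
  have : {z : Fin d → ℤ | ‖corner h z‖ ≤ R} ⊆
      Set.Icc (fun _ => -⌈R / h⌉) (fun _ => ⌈R / h⌉) := by
    intro z hz
    have hb : ∀ j, |(z j : ℝ)| ≤ R / h := by
      intro j
      have := (abs_coord_le_norm (corner h z) j).trans hz
      rw [corner_apply, abs_mul, abs_of_pos hh] at this
      rw [le_div_iff₀ hh]
      linarith
    constructor
    · intro j
      have := (abs_le.1 (hb j)).1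
      have h2 := Int.le_ceil (R / h)
      have : (-⌈R / h⌉ : ℝ) ≤ z j := by linarith
      exact_mod_cast this
    · intro j
      have := (abs_le.1 (hb j)).2
      have h2 := Int.le_ceil (R / h)
      have : (z j : ℝ) ≤ ⌈R / h⌉ := by linarith
      exact_mod_cast this
  exact (Set.finite_Icc _ _).subset this

theorem finite_cell_meets {h : ℝ} (hh : 0 < h) {C : Set (Space d)} (hC : Bornology.IsBounded C) :
    {z : Fin d → ℤ | (cell h z ∩ C).Nonempty}.Finite := by
  obtain ⟨R, hR⟩ := hC.subset_closedBall 0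
  apply (finite_norm_corner_le hh (R + d * h)).subset
  rintro z ⟨x, hx, hxC⟩
  have h1 := cube_subset_closedBall _ hh.le hx
  have h2 := hR hxC
  rw [Metric.mem_closedBall, dist_eq_norm] at h1 h2
  rw [sub_zero] at h2
  have : corner h z = x - (x - corner h z) := by abel
  rw [Set.mem_ofPred_eq, this]
  exact (norm_sub_le _ _).trans (by linarith)

theorem volume_biUnion_cell {h : ℝ} (hh : 0 < h) (Z : Finset (Fin d → ℤ)) :
    volume (⋃ z ∈ Z, cell h z) = Z.card * ENNReal.ofReal (h ^ d) := by
  rw [measure_biUnion_finset]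
  · simp [cell, volume_cube' _ hh.le]
  · intro z _ w _ hzw
    exact pairwise_disjoint_cell hh hzw
  · intro z _
    exact measurableSet_cube _ _

/-- A compact set is covered by finitely many cells of a fine grid, with little waste. -/
theorem exists_cells_cover_compact {C : Set (Space d)} (hC : IsCompact C) {v : ℝ≥0∞}
    (hv : volume C < v) : ∃ h : ℝ, 0 < h ∧ ∃ Z : Finset (Fin d → ℤ),
      C ⊆ (⋃ z ∈ Z, cell h z) ∧ Z.card * ENNReal.ofReal (h ^ d) ≤ v := by
  obtain ⟨U, hCU, hU, hUv⟩ := C.exists_isOpen_lt_of_lt v hv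
  obtain ⟨δ, hδ, hδU⟩ := hC.exists_thickening_subset_open hU hCU
  -- Two points of a cell are at distance at most d * h < δ, so every cell meeting C stays in the
  -- δ-thickening, hence in U.
  set h : ℝ := δ / (d + 1) with hh
  have hpos : 0 < h := by positivity
  have hfin := finite_cell_meets hpos hC.isBounded
  refine ⟨h, hpos, hfin.toFinset, ?_, ?_⟩
  · intro x hx
    simp only [Set.Finite.mem_toFinset, Set.mem_ofPred_eq, Set.mem_iUnion]
    exact ⟨_, ⟨x, mem_cell_floor hpos x, hx⟩, mem_cell_floor hpos x⟩
  · rw [← volume_biUnion_cell hpos]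
    refine (measure_mono ?_).trans hUv.le
    refine Set.iUnion₂_subset fun z hz => ?_
    rw [Set.Finite.mem_toFinset] at hz
    obtain ⟨x, hx, hxC⟩ := hz
    intro y hy
    apply hδU
    rw [Metric.mem_thickening_iff]
    refine ⟨x, hxC, ?_⟩
    rw [dist_eq_norm]
    have : ‖y - x‖ ≤ d * h := by
      apply norm_le_of_coord_le hpos.le
      intro j
      have h1 := hx j
      have h2 := hy j
      rw [PiLp.sub_apply, abs_le]
      constructor <;> linarith [h1.1, h1.2, h2.1, h2.2]
    refine this.trans_lt ?_
    have : (d + 1) * h = δ := by rw [hh]; field_simp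
    linarith

theorem volume_body (K : Set (Space d)) (x : Space d) {r : ℝ} (hr : 0 ≤ r) :
    volume (x +ᵥ r • K) = ENNReal.ofReal (r ^ d) * volume K := by
  rw [measure_vadd, Measure.addHaar_smul_of_nonneg _ hr, finrank_euclideanSpace_fin]

/-- A larger homothet of a convex set contains a translate of a smaller one. -/
theorem exists_vadd_smul_subset {K : Set (Space d)} (hK : Convex ℝ K) (hne : K.Nonempty)
    {r t : ℝ} (hr : 0 ≤ r) (hrt : r ≤ t) : ∃ v : Space d, v +ᵥ r • K ⊆ t • K := by
  obtain ⟨p, hp⟩ := hne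
  refine ⟨(t - r) • p, ?_⟩
  rintro _ ⟨_, ⟨k, hk, rfl⟩, rfl⟩
  -- This is where convexity enters; fixing one point p of K in the first summand gives the
  -- translate.
  have : t • K = (t - r) • K + r • K := by
    rw [← hK.add_smul (by linarith) hr]
    congr 1
    ring
  rw [this]
  exact Set.add_mem_add (Set.smul_mem_smul_set hp) (Set.smul_mem_smul_set hk)

end

/-! ### Densities of arrangements subordinate to a tiling -/

section

variable {d : ℕ} {ι J : Type*}

/-- A packing by measurable sets `Q j` such that `Q j` lies in the ball with centre `p j` and
radius `ρ j`, where `ρ j = o(‖p j‖)`. -/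
structure IsSlowPacking (Q : J → Set (Space d)) (p : J → Space d) (ρ : J → ℝ) : Prop where
  measurableSet : ∀ j, MeasurableSet (Q j)
  disjoint : Pairwise (Function.onFun Disjoint Q)
  subset : ∀ j, Q j ⊆ Metric.closedBall (p j) (ρ j)
  slow : ∀ η : ℝ, 0 < η → {j | η * ‖p j‖ < ρ j}.Finite

theorem volume_closedBall_zero {r : ℝ} (hr : 0 ≤ r) :
    volume (Metric.closedBall (0 : Space d) r) =
      ENNReal.ofReal (r ^ d) * volume (Metric.ball (0 : Space d) 1) := by
  rw [Measure.addHaar_closedBall _ _ hr, finrank_euclideanSpace_fin]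

theorem volume_closedBall_ne_zero {r : ℝ} (hr : 0 < r) :
    volume (Metric.closedBall (0 : Space d) r) ≠ 0 :=
  (Metric.measure_closedBall_pos volume 0 hr).ne'

theorem volume_closedBall_ne_top (r : ℝ) :
    volume (Metric.closedBall (0 : Space d) r) ≠ ⊤ := measure_closedBall_lt_top.ne

theorem volume_closedBall_mul {κ r : ℝ} (hκ : 0 ≤ κ) (hr : 0 ≤ r) :
    volume (Metric.closedBall (0 : Space d) (κ * r)) =
      ENNReal.ofReal (κ ^ d) * volume (Metric.closedBall (0 : Space d) r) := by
  rw [volume_closedBall_zero hr, volume_closedBall_zero (mul_nonneg hκ hr), mul_pow,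
    ENNReal.ofReal_mul (pow_nonneg hκ d), mul_assoc]

theorem tendsto_volume_closedBall (hd : 1 ≤ d) :
    Tendsto (fun r : ℝ => volume (Metric.closedBall (0 : Space d) r)) atTop (𝓝 ⊤) := by
  have hb : volume (Metric.ball (0 : Space d) 1) ≠ 0 := (Metric.measure_ball_pos volume 0 one_pos).ne'
  have h1 : Tendsto (fun r : ℝ => ENNReal.ofReal (r ^ d) * volume (Metric.ball (0 : Space d) 1))
      atTop (𝓝 (⊤ * volume (Metric.ball (0 : Space d) 1))) := by
    apply ENNReal.Tendsto.mul_const _ (Or.inl ENNReal.top_ne_zero)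
    exact ENNReal.tendsto_ofReal_atTop.comp (tendsto_pow_atTop (by omega))
  rw [ENNReal.top_mul hb] at h1
  refine h1.congr' ?_
  filter_upwards [eventually_ge_atTop 0] with r hr
  rw [volume_closedBall_zero hr]

theorem tendsto_div_volume_closedBall (hd : 1 ≤ d) {C : ℝ≥0∞} (hC : C ≠ ⊤) :
    Tendsto (fun r : ℝ => C / volume (Metric.closedBall (0 : Space d) r)) atTop (𝓝 0) := by
  have := ENNReal.Tendsto.const_div (tendsto_volume_closedBall hd) (Or.inr hC)
  rwa [ENNReal.div_top] at this

open Classical in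
theorem IsSlowPacking.tsum_volume_le {Q : J → Set (Space d)} {p : J → Space d} {ρ : J → ℝ}
    (h : IsSlowPacking Q p ρ) (B : Set (Space d)) :
    ∑' j, (if Q j ⊆ B then volume (Q j) else 0) ≤ volume B := by
  have h1 : ∑' j, (if Q j ⊆ B then volume (Q j) else 0) =
      ∑' j : {j | Q j ⊆ B}, volume (Q j) := by
    rw [tsum_subtype {j | Q j ⊆ B} (fun j => volume (Q j))]
    rfl
  rw [h1]
  refine (tsum_meas_le_meas_iUnion_of_disjoint volume
    (fun j : {j | Q j ⊆ B} => h.measurableSet j) ?_).trans (measure_mono ?_)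
  · intro i j hij
    exact h.disjoint (fun h => hij (Subtype.ext h))
  · exact Set.iUnion_subset fun j => j.2

/-- The contraction factor used to compare balls in the density estimates tends to one. -/
theorem tendsto_shrink_pow (d : ℕ) :
    Tendsto (fun η : ℝ => (((1 + η) / (1 - η)) ^ d)) (𝓝[>] 0) (𝓝 1) := by
  have : ContinuousAt (fun η : ℝ => (((1 + η) / (1 - η)) ^ d)) 0 := by
    apply ContinuousAt.pow
    apply ContinuousAt.div <;> first | fun_prop | norm_num
  have h := this.tendsto
  simp only [add_zero, sub_zero, div_one, one_pow] at h
  exact h.mono_left nhdsWithin_le_nhds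

/-- Each member is charged to the tile `τ i`. Apart from finitely many tiles, ρ j ≤ η‖p j‖ and the
charge is at most (δ+η) times the volume of the tile. If such a tile is charged with a member
meeting the ball of radius r, then (1-η)‖p j‖ ≤ r, so the tile lies in the ball of radius κr with κ
= (1+η)/(1-η). Disjointness bounds the sum, the exceptional tiles contribute O(1), and η → 0. -/
theorem IsSlowPacking.upperDensity_le (hd : 1 ≤ d) {Q : J → Set (Space d)} {p : J → Space d}
    {ρ : J → ℝ} (h : IsSlowPacking Q p ρ) {A : ι → Set (Space d)} {τ : ι → J}
    (hA : ∀ i, A i ⊆ Metric.closedBall (p (τ i)) (ρ (τ i))) {V : J → ℝ≥0∞} (hVtop : ∀ j, V j ≠ ⊤)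
    (hV : ∀ j, ∑' i : τ ⁻¹' {j}, volume (A i) ≤ V j) {δ : ℝ≥0∞} (hδ : δ ≠ ⊤)
    (hVδ : ∀ ε : ℝ, 0 < ε → {j | (δ + ENNReal.ofReal ε) * volume (Q j) < V j}.Finite) :
    upperDensity A ≤ δ := by
  classical
  have key : ∀ η : ℝ, 0 < η → η < 1 → upperDensity A ≤
      (δ + ENNReal.ofReal η) * ENNReal.ofReal (((1 + η) / (1 - η)) ^ d) := by
    intro η h0 h1
    set κ : ℝ := (1 + η) / (1 - η) with hκ
    have hκ0 : 0 ≤ κ := div_nonneg (by linarith) (by linarith)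
    set F : Finset J := (h.slow η h0).toFinset ∪ (hVδ η h0).toFinset with hF
    have hFin : ∀ j, j ∉ F → ρ j ≤ η * ‖p j‖ ∧ V j ≤ (δ + ENNReal.ofReal η) * volume (Q j) := by
      intro j hj
      simpa [hF] using hj
    set C : ℝ≥0∞ := ∑ j ∈ F, V j with hC
    have hCtop : C ≠ ⊤ := ENNReal.sum_ne_top.2 fun j _ => hVtop j
    have hbound : ∀ r : ℝ, 0 < r → outerDensity A (Metric.closedBall 0 r) ≤
        C / volume (Metric.closedBall (0 : Space d) r) +
          (δ + ENNReal.ofReal η) * ENNReal.ofReal (κ ^ d) := by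
      intro r hr
      set B := Metric.closedBall (0 : Space d) r with hB
      set B' := Metric.closedBall (0 : Space d) (κ * r) with hB'
      have hsum : (∑' i : {i : ι // (A i ∩ B).Nonempty}, volume (A i)) ≤
          C + (δ + ENNReal.ofReal η) * volume B' := by
        have e1 : (∑' i : {i : ι // (A i ∩ B).Nonempty}, volume (A i)) =
            ∑' i, ({i : ι | (A i ∩ B).Nonempty}.indicator (fun i => volume (A i))) i :=
          tsum_subtype {i : ι | (A i ∩ B).Nonempty} (fun i => volume (A i))
        rw [e1, ← ENNReal.tsum_fiberwise _ τ]
        have hj : ∀ j, ∑' i : τ ⁻¹' {j},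
            ({i : ι | (A i ∩ B).Nonempty}.indicator (fun i => volume (A i))) i ≤
            (if j ∈ F then V j else 0) +
              (δ + ENNReal.ofReal η) * (if Q j ⊆ B' then volume (Q j) else 0) := by
          intro j
          have hle : ∑' i : τ ⁻¹' {j},
              ({i : ι | (A i ∩ B).Nonempty}.indicator (fun i => volume (A i))) i ≤ V j := by
            refine le_trans (ENNReal.tsum_le_tsum fun i => ?_) (hV j)
            exact Set.indicator_le_self _ _ _
          by_cases hjF : j ∈ F
          · rw [if_pos hjF]
            exact hle.trans le_self_add
          · rw [if_neg hjF, zero_add]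
            obtain ⟨hρ, hVj⟩ := hFin j hjF
            by_cases hmeet : ∃ i, τ i = j ∧ (A i ∩ B).Nonempty
            · obtain ⟨i, rfl, x, hxA, hxB⟩ := hmeet
              have hx1 := hA i hxA
              rw [hB, mem_closedBall_zero_iff] at hxB
              rw [Metric.mem_closedBall, dist_eq_norm] at hx1
              have hp : ‖p (τ i)‖ ≤ r + η * ‖p (τ i)‖ := by
                have : p (τ i) = x - (x - p (τ i)) := by abel
                calc ‖p (τ i)‖ = ‖x - (x - p (τ i))‖ := by rw [← this]
                  _ ≤ ‖x‖ + ‖x - p (τ i)‖ := norm_sub_le _ _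
                  _ ≤ _ := by linarith
              have hsub : Q (τ i) ⊆ B' := by
                intro y hy
                have hy1 := h.subset _ hy
                rw [Metric.mem_closedBall, dist_eq_norm] at hy1
                rw [hB', mem_closedBall_zero_iff]
                have : y = p (τ i) + (y - p (τ i)) := by abel
                have h2 : ‖y‖ ≤ (1 + η) * ‖p (τ i)‖ := by
                  calc ‖y‖ = ‖p (τ i) + (y - p (τ i))‖ := by rw [← this]
                    _ ≤ ‖p (τ i)‖ + ‖y - p (τ i)‖ := norm_add_le _ _
                    _ ≤ _ := by linarith
                refine h2.trans ?_
                rw [hκ, div_mul_eq_mul_div, le_div_iff₀ (by linarith)]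
                nlinarith
              rw [if_pos hsub]
              exact hle.trans hVj
            · push Not at hmeet
              have : ∑' i : τ ⁻¹' {j},
                  ({i : ι | (A i ∩ B).Nonempty}.indicator (fun i => volume (A i))) i = 0 := by
                rw [ENNReal.tsum_eq_zero]
                intro i
                rw [Set.indicator_of_notMem]
                intro hi
                exact (Set.nonempty_iff_ne_empty.1 hi) (hmeet i i.2)
              rw [this]
              exact zero_le
        refine (ENNReal.tsum_le_tsum hj).trans ?_
        rw [ENNReal.tsum_add, ENNReal.tsum_mul_left]
        gcongr
        · rw [hC, tsum_eq_sum (s := F)]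
          · exact (Finset.sum_congr rfl fun j hj => if_pos hj).le
          · intro j hj
            exact if_neg hj
        · exact h.tsum_volume_le B'
      rw [outerDensity]
      calc _ ≤ (C + (δ + ENNReal.ofReal η) * volume B') / volume B := by gcongr
        _ = _ := by
          rw [ENNReal.add_div, hB', volume_closedBall_mul hκ0 hr.le, mul_div_assoc, mul_div_assoc,
            ENNReal.div_self (volume_closedBall_ne_zero hr) (volume_closedBall_ne_top r), mul_one]
    have hlim : Tendsto (fun r : ℝ => C / volume (Metric.closedBall (0 : Space d) r) +
          (δ + ENNReal.ofReal η) * ENNReal.ofReal (κ ^ d)) atTop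
          (𝓝 (0 + (δ + ENNReal.ofReal η) * ENNReal.ofReal (κ ^ d))) :=
      (tendsto_div_volume_closedBall hd hCtop).add_const _
    rw [zero_add] at hlim
    rw [← hlim.limsup_eq]
    refine limsup_le_limsup ?_
    filter_upwards [eventually_gt_atTop 0] with r hr using hbound r hr
  have hlim : Tendsto (fun η : ℝ => (δ + ENNReal.ofReal η) *
      ENNReal.ofReal (((1 + η) / (1 - η)) ^ d)) (𝓝[>] 0) (𝓝 ((δ + 0) * ENNReal.ofReal 1)) := by
    apply ENNReal.Tendsto.mul
    · apply Tendsto.const_add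
      have : Tendsto (fun η : ℝ => ENNReal.ofReal η) (𝓝[>] 0) (𝓝 (ENNReal.ofReal 0)) :=
        (ENNReal.continuous_ofReal.tendsto 0).mono_left nhdsWithin_le_nhds
      simpa using this
    · right; simp
    · exact (ENNReal.continuous_ofReal.tendsto 1).comp (tendsto_shrink_pow d)
    · right; simpa using hδ
  simp only [add_zero, ENNReal.ofReal_one, mul_one] at hlim
  refine ge_of_tendsto hlim ?_
  filter_upwards [Ioo_mem_nhdsGT (zero_lt_one' ℝ)] with η hη using key η hη.1 hη.2

/-- Dual to the upper estimate: the tiles meeting the ball of radius r/κ cover it, and apart from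
finitely many of them all the members charged to them lie in the ball of radius r. -/
theorem IsSlowPacking.le_lowerDensity (hd : 1 ≤ d) [Countable J] {Q : J → Set (Space d)}
    {p : J → Space d} {ρ : J → ℝ} (h : IsSlowPacking Q p ρ) (hcov : ⋃ j, Q j = Set.univ)
    {A : ι → Set (Space d)} {τ : ι → J}
    (hA : ∀ i, A i ⊆ Metric.closedBall (p (τ i)) (ρ (τ i))) {V : J → ℝ≥0∞}
    (hV : ∀ j, V j ≤ ∑' i : τ ⁻¹' {j}, volume (A i)) {δ : ℝ≥0∞} (hδ : δ ≠ ⊤)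
    (hVδ : ∀ ε : ℝ, 0 < ε → {j | V j < (δ - ENNReal.ofReal ε) * volume (Q j)}.Finite) :
    δ ≤ lowerDensity A := by
  classical
  have hQfin : ∀ j, volume (Q j) ≠ ⊤ := fun j =>
    ((measure_mono (h.subset j)).trans_lt measure_closedBall_lt_top).ne
  have key : ∀ η : ℝ, 0 < η → η < 1 →
      (δ - ENNReal.ofReal η) ≤ ENNReal.ofReal (((1 + η) / (1 - η)) ^ d) * lowerDensity A := by
    intro η h0 h1
    set κ : ℝ := (1 + η) / (1 - η) with hκ
    have hκ0 : 0 < κ := div_pos (by linarith) (by linarith)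
    set F : Finset J := (h.slow η h0).toFinset ∪ (hVδ η h0).toFinset with hF
    have hFin : ∀ j, j ∉ F → ρ j ≤ η * ‖p j‖ ∧ (δ - ENNReal.ofReal η) * volume (Q j) ≤ V j := by
      intro j hj
      simpa [hF] using hj
    set C : ℝ≥0∞ := (δ - ENNReal.ofReal η) * ∑ j ∈ F, volume (Q j) with hC
    have hCtop : C ≠ ⊤ := ENNReal.mul_ne_top (ENNReal.sub_ne_top hδ)
      (ENNReal.sum_ne_top.2 fun j _ => hQfin j)
    have hbound : ∀ r : ℝ, 0 < r → (δ - ENNReal.ofReal η) ≤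
        ENNReal.ofReal (κ ^ d) * (C / volume (Metric.closedBall (0 : Space d) r) +
          innerDensity A (Metric.closedBall 0 r)) := by
      intro r hr
      set B := Metric.closedBall (0 : Space d) r with hB
      set B' := Metric.closedBall (0 : Space d) (r / κ) with hB'
      have hsum : (δ - ENNReal.ofReal η) * volume B' ≤
          C + ∑' i : {i : ι // A i ⊆ B}, volume (A i) := by
        have e1 : (∑' i : {i : ι // A i ⊆ B}, volume (A i)) =
            ∑' i, ({i : ι | A i ⊆ B}.indicator (fun i => volume (A i))) i :=
          tsum_subtype {i : ι | A i ⊆ B} (fun i => volume (A i))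
        rw [e1, ← ENNReal.tsum_fiberwise _ τ]
        have hB'le : volume B' ≤ ∑' j, (if (Q j ∩ B').Nonempty then volume (Q j) else 0) := by
          calc volume B' ≤ volume (⋃ j, Q j ∩ B') := by
                rw [← Set.iUnion_inter, hcov, Set.univ_inter]
            _ ≤ ∑' j, volume (Q j ∩ B') := measure_iUnion_le _
            _ ≤ _ := by
              refine ENNReal.tsum_le_tsum fun j => ?_
              split_ifs with hne
              · exact measure_mono Set.inter_subset_left
              · rw [Set.not_nonempty_iff_eq_empty.1 hne, measure_empty]
        have hj : ∀ j, (δ - ENNReal.ofReal η) *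
            (if (Q j ∩ B').Nonempty then volume (Q j) else 0) ≤
            (if j ∈ F then (δ - ENNReal.ofReal η) * volume (Q j) else 0) + ∑' i : τ ⁻¹' {j},
            ({i : ι | A i ⊆ B}.indicator (fun i => volume (A i))) i := by
          intro j
          split_ifs with hne hjF hjF
          · exact le_self_add
          · rw [zero_add]
            obtain ⟨hρ, hVj⟩ := hFin j hjF
            refine hVj.trans ((hV j).trans ?_)
            refine ENNReal.tsum_le_tsum fun i => ?_
            obtain ⟨i, rfl⟩ := i
            rw [Set.indicator_of_mem]
            obtain ⟨x, hxQ, hxB⟩ := hne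
            have hx1 := h.subset _ hxQ
            rw [hB', mem_closedBall_zero_iff] at hxB
            rw [Metric.mem_closedBall, dist_eq_norm] at hx1
            have hp : ‖p (τ i)‖ ≤ r / κ + η * ‖p (τ i)‖ := by
              have : p (τ i) = x - (x - p (τ i)) := by abel
              calc ‖p (τ i)‖ = ‖x - (x - p (τ i))‖ := by rw [← this]
                _ ≤ ‖x‖ + ‖x - p (τ i)‖ := norm_sub_le _ _
                _ ≤ _ := by linarith
            intro y hy
            have hy1 := hA _ hy
            rw [Metric.mem_closedBall, dist_eq_norm] at hy1
            rw [hB, mem_closedBall_zero_iff]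
            have : y = p (τ i) + (y - p (τ i)) := by abel
            have h2 : ‖y‖ ≤ (1 + η) * ‖p (τ i)‖ := by
              calc ‖y‖ = ‖p (τ i) + (y - p (τ i))‖ := by rw [← this]
                _ ≤ ‖p (τ i)‖ + ‖y - p (τ i)‖ := norm_add_le _ _
                _ ≤ _ := by linarith
            have h3 : (1 - η) * ‖p (τ i)‖ ≤ r / κ := by linarith
            rw [le_div_iff₀ hκ0, hκ] at h3
            have h4 : (1 - η) * ‖p (τ i)‖ * ((1 + η) / (1 - η)) = (1 + η) * ‖p (τ i)‖ := by
              field_simp [(by linarith : (1 - η) ≠ 0)]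
            linarith
          · simp
          · simp
        calc (δ - ENNReal.ofReal η) * volume B'
            ≤ (δ - ENNReal.ofReal η) * ∑' j, (if (Q j ∩ B').Nonempty then volume (Q j) else 0) := by
              gcongr
          _ ≤ _ := by
            rw [← ENNReal.tsum_mul_left]
            refine (ENNReal.tsum_le_tsum hj).trans ?_
            rw [ENNReal.tsum_add]
            gcongr
            rw [hC, Finset.mul_sum, tsum_eq_sum (s := F)]
            · exact (Finset.sum_congr rfl fun j hj => if_pos hj).le
            · intro j hj
              exact if_neg hj
      have hBB : volume B = ENNReal.ofReal (κ ^ d) * volume B' := by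
        rw [hB', ← volume_closedBall_mul hκ0.le (by positivity), mul_div_cancel₀ _ hκ0.ne']
      have hBne := volume_closedBall_ne_zero (d := d) hr
      have hBtop := volume_closedBall_ne_top (d := d) r
      rw [innerDensity, ← ENNReal.add_div, ← mul_div_assoc,
        ENNReal.le_div_iff_mul_le (Or.inl hBne) (Or.inl hBtop)]
      calc (δ - ENNReal.ofReal η) * volume B
          = ENNReal.ofReal (κ ^ d) * ((δ - ENNReal.ofReal η) * volume B') := by rw [hBB]; ring
        _ ≤ _ := by gcongr
    have h2 : liminf (fun r : ℝ => C / volume (Metric.closedBall (0 : Space d) r) +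
          innerDensity A (Metric.closedBall 0 r)) atTop = lowerDensity A :=
      ENNReal.liminf_add_of_left_tendsto_zero (tendsto_div_volume_closedBall hd hCtop) _
    have hk0 : ENNReal.ofReal (κ ^ d) ≠ 0 := by
      rw [Ne, ENNReal.ofReal_eq_zero, not_le]
      positivity
    rw [← h2, mul_comm, ← ENNReal.div_le_iff hk0 ENNReal.ofReal_ne_top]
    refine le_liminf_of_le ?_ ?_
    · isBoundedDefault
    filter_upwards [eventually_gt_atTop 0] with r hr
    rw [ENNReal.div_le_iff hk0 ENNReal.ofReal_ne_top, mul_comm]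
    exact hbound r hr
  by_cases hL : lowerDensity A = ⊤
  · rw [hL]; exact le_top
  have hlim : Tendsto (fun η : ℝ =>
      ENNReal.ofReal (((1 + η) / (1 - η)) ^ d) * lowerDensity A) (𝓝[>] 0)
      (𝓝 (ENNReal.ofReal 1 * lowerDensity A)) := by
    apply ENNReal.Tendsto.mul_const
    · exact (ENNReal.continuous_ofReal.tendsto 1).comp (tendsto_shrink_pow d)
    · right; exact hL
  have hlim' : Tendsto (fun η : ℝ => δ - ENNReal.ofReal η) (𝓝[>] 0) (𝓝 (δ - ENNReal.ofReal 0)) := by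
    apply ENNReal.Tendsto.sub tendsto_const_nhds
    · exact (ENNReal.continuous_ofReal.tendsto 0).mono_left nhdsWithin_le_nhds
    · left; exact hδ
  simp only [ENNReal.ofReal_one, one_mul, ENNReal.ofReal_zero, tsub_zero] at hlim hlim'
  refine le_of_tendsto_of_tendsto hlim' hlim ?_
  filter_upwards [Ioo_mem_nhdsGT (zero_lt_one' ℝ)] with η hη using key η hη.1 hη.2

theorem lowerDensity_le_upperDensity {A : ι → Set (Space d)} (hA : ∀ i, (A i).Nonempty) :
    lowerDensity A ≤ upperDensity A := by
  refine (liminf_le_liminf (Eventually.of_forall fun r => ?_)).trans liminf_le_limsup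
  rw [innerDensity, outerDensity]
  gcongr
  set B := Metric.closedBall (0 : Space d) r
  have e1 : (∑' i : {i : ι // (A i ∩ B).Nonempty}, volume (A i)) =
      ∑' i, ({i : ι | (A i ∩ B).Nonempty}.indicator (fun i => volume (A i))) i :=
    tsum_subtype {i : ι | (A i ∩ B).Nonempty} (fun i => volume (A i))
  have e2 : (∑' i : {i : ι // A i ⊆ B}, volume (A i)) =
      ∑' i, ({i : ι | A i ⊆ B}.indicator (fun i => volume (A i))) i :=
    tsum_subtype {i : ι | A i ⊆ B} (fun i => volume (A i))
  rw [e1, e2]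
  refine ENNReal.tsum_le_tsum fun i => ?_
  refine Set.indicator_le_indicator_of_subset ?_ (fun _ => zero_le) i
  intro i hi
  obtain ⟨x, hx⟩ := hA i
  exact ⟨x, hx, hi hx⟩

end

/-! ### The translative covering density and coverings of cubes -/

section

variable {d : ℕ}

theorem isSlowPacking_cell {h R : ℝ} (hh : 0 < h) (hR : d * h ≤ R) :
    IsSlowPacking (cell h : (Fin d → ℤ) → Set (Space d)) (corner h) (fun _ => R) where
  measurableSet _ := measurableSet_cube _ _
  disjoint := pairwise_disjoint_cell hh
  subset z := (cube_subset_closedBall _ hh.le).trans (Metric.closedBall_subset_closedBall hR)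
  slow η hη := by
    refine (finite_norm_corner_le (d := d) hh (R / η)).subset fun z hz => ?_
    rw [Set.mem_ofPred_eq] at hz ⊢
    rw [le_div_iff₀ hη]
    linarith

theorem iUnion_cell {h : ℝ} (hh : 0 < h) :
    ⋃ z, cell h z = (Set.univ : Set (Space d)) :=
  Set.eq_univ_of_forall fun x => Set.mem_iUnion.2 ⟨_, mem_cell_floor hh x⟩

theorem volume_cell {h : ℝ} (hh : 0 < h) (z : Fin d → ℤ) :
    volume (cell h z) = ENNReal.ofReal (h ^ d) := volume_cube' _ hh.le

/-- A covering of a cube by translates of `K` extends periodically, hence bounds the covering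
density from above. -/
theorem coveringDensity_le (hd : 1 ≤ d) {K : Set (Space d)} (hb : Bornology.IsBounded K)
    (hne : K.Nonempty) {s : ℝ} (hs : 0 < s) {X : Finset (Space d)}
    (hX : cube 0 s ⊆ ⋃ x ∈ X, x +ᵥ K) :
    coveringDensity K ≤ X.card * volume K / ENNReal.ofReal (s ^ d) := by
  classical
  have hKtop : volume K ≠ ⊤ := hb.measure_lt_top.ne
  have hsd : ENNReal.ofReal (s ^ d) ≠ 0 := by
    rw [Ne, ENNReal.ofReal_eq_zero, not_le]
    positivity
  have hbX : Bornology.IsBounded (⋃ x ∈ X, x +ᵥ K) := by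
    rw [Bornology.isBounded_biUnion_finset]
    intro x _
    exact hb.vadd x
  obtain ⟨R, hR⟩ := hbX.subset_closedBall 0
  set T : Set (Space d) := {t | ∃ x ∈ X, ∃ z, t = corner s z + x} with hT
  have hmem : ∀ t : T, ∃ x ∈ X, ∃ z, t.1 = corner s z + x := fun t => t.2
  -- A vector may be a lattice vector plus an element of X in several ways. Once one way is fixed,
  -- `ξ` is injective on each fibre of `τ`, so a cell is charged with at most |X| bodies.
  choose ξ hξ τ hτ using hmem
  have hcov : CoversSpace (fun t : T => t.1 +ᵥ K) := by
    refine Set.eq_univ_of_forall fun y => ?_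
    set z : Fin d → ℤ := fun j => ⌊y j / s⌋
    have hy : y ∈ cell s z := mem_cell_floor hs y
    have hy' : y - corner s z ∈ cube 0 s := by
      intro j
      have := hy j
      rw [PiLp.sub_apply, PiLp.zero_apply]
      constructor <;> linarith [this.1, this.2]
    obtain ⟨x, hx, k, hk, hxk⟩ := Set.mem_iUnion₂.1 (hX hy')
    refine Set.mem_iUnion.2 ⟨⟨corner s z + x, x, hx, z, rfl⟩, k, hk, ?_⟩
    simp only [vadd_eq_add] at hxk ⊢
    rw [add_assoc, hxk]
    abel
  have hup : upperDensity (fun t : T => t.1 +ᵥ K) ≤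
      X.card * volume K / ENNReal.ofReal (s ^ d) := by
    refine (isSlowPacking_cell (R := max R (d * s)) hs (le_max_right _ _)).upperDensity_le hd
      (τ := τ) (V := fun _ => X.card * volume K) ?_ ?_ ?_ ?_ ?_
    · rintro t _ ⟨k, hk, rfl⟩
      have h1 : ξ t + k ∈ Metric.closedBall (0 : Space d) R :=
        hR (Set.mem_iUnion₂.2 ⟨ξ t, hξ t, k, hk, rfl⟩)
      rw [mem_closedBall_zero_iff] at h1
      rw [Metric.mem_closedBall, dist_eq_norm]
      simp only [vadd_eq_add]
      rw [hτ t, add_assoc, add_sub_cancel_left]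
      exact h1.trans (le_max_left _ _)
    · intro _
      exact ENNReal.mul_ne_top (ENNReal.natCast_ne_top _) hKtop
    · intro z
      simp only [measure_vadd]
      have hinj : Function.Injective (fun t : τ ⁻¹' {z} => (⟨ξ t, hξ t⟩ : X)) := by
        rintro ⟨t, ht⟩ ⟨u, hu⟩ htu
        have h1 : ξ t = ξ u := congrArg Subtype.val htu
        have h2 : τ t = τ u := by
          rw [Set.mem_preimage, Set.mem_singleton_iff] at ht hu
          rw [ht, hu]
        have h3 : t.1 = u.1 := by rw [hτ t, hτ u, h1, h2]
        exact Subtype.ext (Subtype.ext h3)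
      calc ∑' _t : τ ⁻¹' {z}, volume K ≤ ∑' _x : X, volume K :=
            ENNReal.tsum_comp_le_tsum_of_injective hinj (fun _ => volume K)
        _ = X.card * volume K := by simp
    · exact ENNReal.div_ne_top (ENNReal.mul_ne_top (ENNReal.natCast_ne_top _) hKtop) hsd
    · intro ε hε
      convert Set.finite_empty
      rw [Set.eq_empty_iff_forall_notMem]
      intro z
      rw [Set.mem_ofPred_eq, not_lt, volume_cell hs, add_mul,
        ENNReal.div_mul_cancel hsd ENNReal.ofReal_ne_top]
      exact le_self_add
  rw [coveringDensity]
  refine (iInf₂_le T hcov).trans ((lowerDensity_le_upperDensity ?_).trans hup)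
  intro t
  exact hne.vadd_set

/-- Large cubes can be covered by translates of `K` with density close to the covering density. -/
theorem exists_cover_cube (hd : 1 ≤ d) {K : Set (Space d)} {D : ℝ} (hD : 0 ≤ D)
    (hKD : K ⊆ Metric.closedBall 0 D) (hK0 : volume K ≠ 0)
    (htop : coveringDensity K ≠ ⊤) {s ε : ℝ} (hs : 0 < s) (hε : 0 < ε) :
    ∃ X : Finset (Space d), cube 0 s ⊆ (⋃ x ∈ X, x +ᵥ K) ∧
      X.card * volume K ≤ (coveringDensity K + ENNReal.ofReal ε) *
        ENNReal.ofReal ((s + 2 * D) ^ d) := by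
  classical
  -- Averaging argument: if all coverings of the cube were dearer, then in any covering of the space
  -- every cell of width s + 2D would contain the translation vectors of bodies of total volume at
  -- least `b` times its own. All lower densities would be at least `b`, which exceeds their
  -- infimum.
  by_contra hcon
  push Not at hcon
  set b := coveringDensity K + ENNReal.ofReal ε with hbdef
  have hbtop : b ≠ ⊤ := ENNReal.add_ne_top.2 ⟨htop, ENNReal.ofReal_ne_top⟩
  set w : ℝ := s + 2 * D with hw
  have hwpos : 0 < w := by positivity
  have hlow : ∀ T : Set (Space d), CoversSpace (fun t : T => t.1 +ᵥ K) →
      b ≤ lowerDensity (fun t : T => t.1 +ᵥ K) := by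
    intro T hT
    set τ : T → (Fin d → ℤ) := fun t j => ⌊t.1 j / w⌋ with hτ
    have hcell : ∀ t : T, t.1 ∈ cell w (τ t) := fun t => mem_cell_floor hwpos _
    refine (isSlowPacking_cell (R := d * w + D) hwpos (by linarith)).le_lowerDensity hd
      (iUnion_cell hwpos) (τ := τ) (V := fun _ => b * ENNReal.ofReal (w ^ d)) ?_ ?_ hbtop ?_
    · rintro t _ ⟨k, hk, rfl⟩
      have h1 := cube_subset_closedBall _ hwpos.le (hcell t)
      have h2 := hKD hk
      rw [mem_closedBall_zero_iff] at h2
      rw [Metric.mem_closedBall, dist_eq_norm] at h1 ⊢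
      simp only [vadd_eq_add]
      have : t.1 + k - corner w (τ t) = (t.1 - corner w (τ t)) + k := by abel
      rw [this]
      exact (norm_add_le _ _).trans (by linarith)
    · intro z
      simp only [measure_vadd]
      by_cases hfin : Finite (τ ⁻¹' {z})
      · have hfin' : (Subtype.val '' (τ ⁻¹' {z})).Finite := (Set.toFinite _).image _
        -- The cube of side s at `v` keeps the margin D inside the cell, so every body meeting it
        -- has its translation vector in the cell.
        set v : Space d := WithLp.toLp 2 fun j => w * z j + D with hv
        set X : Finset (Space d) := hfin'.toFinset.image (fun t => t - v) with hX
        have hXcard : X.card ≤ Nat.card (τ ⁻¹' {z}) := by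
          refine Finset.card_image_le.trans ?_
          rw [← Set.ncard_eq_toFinset_card _ hfin']
          exact Set.ncard_image_le (Set.toFinite _)
        have hXcov : cube 0 s ⊆ ⋃ x ∈ X, x +ᵥ K := by
          intro y hy
          have hyT : y + v ∈ ⋃ t : T, t.1 +ᵥ K := by
            rw [hT]; trivial
          obtain ⟨t, k, hk, htk⟩ := Set.mem_iUnion.1 hyT
          simp only [vadd_eq_add] at htk
          have hkD := hKD hk
          rw [mem_closedBall_zero_iff] at hkD
          have htz : τ t = z := by
            refine cell_unique hwpos (hcell t) ?_
            intro j
            have h1 := hy j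
            have h2 := abs_le.1 ((abs_coord_le_norm k j).trans hkD)
            have h3 : t.1 j + k j = y j + (w * z j + D) := by
              have := congrArg (fun f : Space d => f j) htk
              simpa [hv] using this
            rw [corner_apply]
            rw [PiLp.zero_apply] at h1
            constructor <;> linarith [h1.1, h1.2, h2.1, h2.2]
          refine Set.mem_iUnion₂.2 ⟨t.1 - v, ?_, k, hk, ?_⟩
          · rw [hX, Finset.mem_image]
            refine ⟨t.1, ?_, rfl⟩
            rw [Set.Finite.mem_toFinset]
            exact ⟨t, htz, rfl⟩
          · simp only [vadd_eq_add]
            rw [sub_add_eq_add_sub, htk, add_sub_cancel_right]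
        refine (hcon X hXcov).le.trans ?_
        have := Fintype.ofFinite (τ ⁻¹' {z})
        rw [tsum_fintype, Finset.sum_const, nsmul_eq_mul, Finset.card_univ, ← Nat.card_eq_fintype_card]
        gcongr
      · rw [not_finite_iff_infinite] at hfin
        rw [ENNReal.tsum_const_eq_top_of_ne_zero hK0]
        exact le_top
    · intro η hη
      convert Set.finite_empty
      rw [Set.eq_empty_iff_forall_notMem]
      intro z
      rw [Set.mem_ofPred_eq, not_lt, volume_cell hwpos]
      gcongr
      exact tsub_le_self
  have h1 : b ≤ coveringDensity K := le_iInf₂ hlow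
  have h2 : coveringDensity K < b := ENNReal.lt_add_right htop (by simpa using hε)
  exact absurd h1 (not_le.2 h2)

end

/-! ### Successive choices, and a tiling by cubes of slowly growing size -/

section

variable {d : ℕ}

/-- Partition of `ℕ` into finite sets, chosen one after the other together with data attached to
their elements and with a state which is updated in every step. -/
theorem exists_partition_of_step {α S : Type*}
    {G : ℕ → S → S → Finset ℕ → (ℕ → α) → Prop}
    (hG : ∀ k s s' I x x', (∀ i ∈ I, x i = x' i) → G k s s' I x → G k s s' I x') (s₀ : S)
    (step : ∀ k U s, ∃ I x s', Disjoint I U ∧ (k ∈ U ∨ k ∈ I) ∧ G k s s' I x) :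
    ∃ (st : ℕ → S) (τ : ℕ → ℕ) (P : ℕ → Finset ℕ) (x : ℕ → α), st 0 = s₀ ∧
      (∀ i k, τ i = k ↔ i ∈ P k) ∧ ∀ k, G k (st k) (st (k + 1)) (P k) x := by
  choose I X N hdisj hmem hGood using step
  let F : ℕ → Finset ℕ × S := fun k => Nat.rec (∅, s₀)
    (fun k q => (q.1 ∪ I k q.1 q.2, N k q.1 q.2)) k
  have hF : ∀ k, F (k + 1) = ((F k).1 ∪ I k (F k).1 (F k).2, N k (F k).1 (F k).2) := fun _ => rfl
  let P : ℕ → Finset ℕ := fun k => I k (F k).1 (F k).2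
  have hmono : Monotone fun k => (F k).1 := by
    apply monotone_nat_of_le_succ
    intro k
    rw [hF]
    exact Finset.subset_union_left
  have hPF : ∀ k, P k ⊆ (F (k + 1)).1 := fun k => by
    rw [hF]
    exact Finset.subset_union_right
  have hFP : ∀ k i, i ∈ (F k).1 → ∃ m, i ∈ P m := by
    intro k
    induction k with
    | zero => intro i hi; simp [F] at hi
    | succ k ih =>
      intro i hi
      rw [hF] at hi
      rcases Finset.mem_union.1 hi with h | h
      · exact ih i h
      · exact ⟨k, h⟩
  -- The clause `k ∈ U ∨ k ∈ I`, read at step i, forces index i into use no later than step i.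
  have hex : ∀ i, ∃ m, i ∈ P m := by
    intro i
    rcases hmem i (F i).1 (F i).2 with h | h
    · exact hFP i i h
    · exact ⟨i, h⟩
  have huniq : ∀ i k m, k < m → i ∈ P k → i ∉ P m := by
    intro i k m hkm hk hm
    have h1 : i ∈ (F m).1 := hmono (Nat.succ_le_of_lt hkm) (hPF k hk)
    exact Finset.disjoint_left.1 (hdisj m (F m).1 (F m).2) hm h1
  choose τ hτ using hex
  have hτ' : ∀ i k, τ i = k ↔ i ∈ P k := by
    intro i k
    constructor
    · rintro rfl; exact hτ i
    · intro hk
      rcases lt_trichotomy (τ i) k with h | h | h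
      · exact absurd hk (huniq i _ _ h (hτ i))
      · exact h
      · exact absurd (hτ i) (huniq i _ _ h hk)
  refine ⟨fun k => (F k).2, τ, P, fun i => X (τ i) (F (τ i)).1 (F (τ i)).2 i, rfl, hτ', ?_⟩
  intro k
  refine hG k _ _ _ _ _ ?_ (hGood k (F k).1 (F k).2)
  intro i hi
  rw [(hτ' i k).2 hi]

/-- The condition on `(n, z)` singling out the cells `cell (2 ^ n) z` in the shell between the
cubes `[-4 ^ n, 4 ^ n)` and `[-4 ^ (n + 1), 4 ^ (n + 1))`. -/
def InShell (q : ℕ × (Fin d → ℤ)) : Prop :=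
  (∀ j, -(4 * 2 ^ q.1) ≤ q.2 j ∧ q.2 j < 4 * 2 ^ q.1) ∧
    (q.1 = 0 ∨ ¬ ∀ j, -(2 ^ q.1) ≤ q.2 j ∧ q.2 j < 2 ^ q.1)

theorem cell_coord_bound {h : ℝ} (hh : 0 < h) {z : Fin d → ℤ} {x : Space d} (hx : x ∈ cell h z)
    (N : ℤ) (j : Fin d) : (-N ≤ z j ∧ z j < N) ↔ (-(N * h) ≤ x j ∧ x j < N * h) := by
  rw [← (mem_cell hh).1 hx j, Int.le_floor, Int.floor_lt, le_div_iff₀ hh, div_lt_iff₀ hh]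
  push_cast
  rw [neg_mul]

/-- The bounds 4^n and 4^(n+1) are multiples of the width 2^n, so no cell crosses the boundary of a
shell, and the shell of a cell can be read off from any of its points. -/
theorem inShell_iff {n : ℕ} {z : Fin d → ℤ} {x : Space d} (hx : x ∈ cell (2 ^ n : ℝ) z) :
    InShell (n, z) ↔ (∀ j, -(4 : ℝ) ^ (n + 1) ≤ x j ∧ x j < 4 ^ (n + 1)) ∧
      (n = 0 ∨ ¬ ∀ j, -(4 : ℝ) ^ n ≤ x j ∧ x j < 4 ^ n) := by
  have e1 : ((2 ^ n : ℤ) : ℝ) * 2 ^ n = 4 ^ n := by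
    push_cast
    rw [← mul_pow]
    norm_num
  have e2 : ((4 * 2 ^ n : ℤ) : ℝ) * 2 ^ n = 4 ^ (n + 1) := by
    rw [Int.cast_mul, mul_assoc, e1, pow_succ]
    push_cast
    ring
  have h1 := fun j => cell_coord_bound (by positivity) hx (4 * 2 ^ n) j
  have h2 := fun j => cell_coord_bound (by positivity) hx (2 ^ n) j
  simp only [e1, e2] at h1 h2
  simp only [InShell, h1, h2]

theorem inShell_unique {q q' : ℕ × (Fin d → ℤ)} (hq : InShell q) (hq' : InShell q') {x : Space d}
    (hx : x ∈ cell (2 ^ q.1 : ℝ) q.2) (hx' : x ∈ cell (2 ^ q'.1 : ℝ) q'.2) : q = q' := by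
  have key : ∀ q q' : ℕ × (Fin d → ℤ), InShell q → InShell q' → x ∈ cell (2 ^ q.1 : ℝ) q.2 →
      x ∈ cell (2 ^ q'.1 : ℝ) q'.2 → ¬ q.1 < q'.1 := by
    intro q q' hq hq' hx hx' hlt
    have h1 := ((inShell_iff hx).1 hq).1
    rcases ((inShell_iff hx').1 hq').2 with h | h
    · omega
    · apply h
      intro j
      have : (4 : ℝ) ^ (q.1 + 1) ≤ 4 ^ q'.1 := pow_le_pow_right₀ (by norm_num) hlt
      constructor <;> linarith [(h1 j).1, (h1 j).2]
  have h1 : q.1 = q'.1 :=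
    le_antisymm (not_lt.1 (key q' q hq' hq hx' hx)) (not_lt.1 (key q q' hq hq' hx hx'))
  refine Prod.ext h1 ?_
  rw [← h1] at hx'
  exact cell_unique (by positivity) hx hx'

theorem exists_inShell (x : Space d) :
    ∃ q : ℕ × (Fin d → ℤ), InShell q ∧ x ∈ cell (2 ^ q.1 : ℝ) q.2 := by
  classical
  have hex : ∃ n : ℕ, ∀ j, -(4 : ℝ) ^ (n + 1) ≤ x j ∧ x j < 4 ^ (n + 1) := by
    obtain ⟨n, hn⟩ := pow_unbounded_of_one_lt ‖x‖ (by norm_num : (1 : ℝ) < 4)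
    refine ⟨n, fun j => ?_⟩
    have h1 := abs_le.1 (abs_coord_le_norm x j)
    have : (4 : ℝ) ^ n ≤ 4 ^ (n + 1) := pow_le_pow_right₀ (by norm_num) (Nat.le_succ n)
    constructor <;> linarith [h1.1, h1.2]
  refine ⟨(Nat.find hex, fun j => ⌊x j / 2 ^ Nat.find hex⌋), ?_, mem_cell_floor (by positivity) x⟩
  refine (inShell_iff (mem_cell_floor (by positivity) x)).2 ⟨Nat.find_spec hex, ?_⟩
  rcases Nat.eq_zero_or_pos (Nat.find hex) with h | h
  · exact Or.inl h
  · right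
    have := Nat.find_min hex (Nat.sub_lt h one_pos)
    have h1 : Nat.find hex - 1 + 1 = Nat.find hex := Nat.sub_add_cancel h
    rwa [h1] at this

theorem finite_inShell_le (N : ℕ) :
    {q : {q : ℕ × (Fin d → ℤ) // InShell q} | q.1.1 ≤ N}.Finite := by
  have hfin : ((Set.Iic N) ×ˢ (Set.Icc (fun _ => -(4 * 2 ^ N)) (fun _ => 4 * 2 ^ N)) :
      Set (ℕ × (Fin d → ℤ))).Finite := (Set.finite_Iic N).prod (Set.finite_Icc _ _)
  refine (hfin.preimage (Subtype.val_injective.injOn)).subset ?_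
  rintro ⟨q, hq⟩ hqN
  have hqN' : q.1 ≤ N := hqN
  have h2 : (2 : ℤ) ^ q.1 ≤ 2 ^ N := pow_le_pow_right₀ (by norm_num) hqN'
  refine ⟨hqN', fun j => ?_, fun j => ?_⟩
  · have := (hq.1 j).1
    change -(4 * 2 ^ N) ≤ q.2 j
    linarith
  · have := (hq.1 j).2
    change q.2 j ≤ 4 * 2 ^ N
    linarith

/-- For n ≥ 1 some coordinate of z has absolute value at least 2^n, so the corner has norm at least
4^n, against a radius O(2^n). The summand R leaves room for bodies of bounded size that stick out of
their tile. -/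
theorem isSlowPacking_inShell {R : ℝ} (hR : 0 ≤ R) :
    IsSlowPacking (fun q : {q : ℕ × (Fin d → ℤ) // InShell q} => cell (2 ^ q.1.1 : ℝ) q.1.2)
      (fun q => corner (2 ^ q.1.1) q.1.2) (fun q => d * 2 ^ q.1.1 + R) where
  measurableSet _ := measurableSet_cube _ _
  disjoint := by
    intro q q' hqq
    rw [Function.onFun, Set.disjoint_left]
    intro x hx hx'
    exact hqq (Subtype.ext (inShell_unique q.2 q'.2 hx hx'))
  subset q := (cube_subset_closedBall _ (by positivity)).trans
    (Metric.closedBall_subset_closedBall (by linarith))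
  slow η hη := by
    obtain ⟨N, hN⟩ := exists_nat_gt ((d + R) / η)
    refine (finite_inShell_le N).subset ?_
    rintro ⟨⟨n, z⟩, hq⟩ hlt
    simp only [Set.mem_ofPred_eq] at hlt ⊢
    by_contra hnN
    push Not at hnN
    have hn0 : n ≠ 0 := by omega
    rcases hq.2 with h | h
    · exact hn0 h
    · push Not at h
      obtain ⟨j, hj⟩ := h
      have habs : (2 : ℝ) ^ n ≤ |(z j : ℝ)| := by
        have : (2 : ℤ) ^ n ≤ |z j| := by
          by_cases hz : -(2 ^ n) ≤ z j
          · exact (hj hz).trans (le_abs_self _)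
          · have := neg_le_abs (z j)
            push Not at hz
            linarith
        have h3 : ((2 ^ n : ℤ) : ℝ) ≤ ((|z j| : ℤ) : ℝ) := Int.cast_le.2 this
        push_cast at h3
        exact h3
      have hnorm := abs_coord_le_norm (corner (2 ^ n) z) j
      rw [corner_apply, abs_mul, abs_of_pos (by positivity : (0 : ℝ) < 2 ^ n)] at hnorm
      have h1 : (2 : ℝ) ^ n * 2 ^ n ≤ ‖corner ((2 : ℝ) ^ n) z‖ :=
        (mul_le_mul_of_nonneg_left habs (by positivity)).trans hnorm
      have h2 : (1 : ℝ) ≤ 2 ^ n := one_le_pow₀ (by norm_num)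
      have h4 : η * (2 ^ n * 2 ^ n) < (d + R) * 2 ^ n := by
        nlinarith
      have h5 : η * 2 ^ n < d + R := by
        by_contra hcon
        push Not at hcon
        nlinarith
      rw [div_lt_iff₀ hη] at hN
      have h6 : (n : ℝ) < 2 ^ n := by exact_mod_cast Nat.lt_two_pow_self
      have h7 : (N : ℝ) < n := by exact_mod_cast hnN
      nlinarith

theorem infinite_inShell (hd : 1 ≤ d) : Infinite {q : ℕ × (Fin d → ℤ) // InShell q} := by
  refine Infinite.of_injective (fun n : ℕ => ⟨(n, fun _ => 2 ^ n), ?_, Or.inr ?_⟩) ?_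
  · intro j
    have : (0 : ℤ) < 2 ^ n := by positivity
    constructor <;> simp only <;> linarith
  · intro h
    exact absurd (h ⟨0, hd⟩).2 (lt_irrefl _)
  · intro n m h
    exact congrArg (fun q => q.1.1) h

end

/-! ### From coverings of cubes to coverings of the space -/

section

variable {d : ℕ}

/-- Every cube can be covered by translates of finitely many of the sets `lam i • K`, with indices
outside of a given finite set, in such a way that the total volume is about `δ` times the volume of
the cube. -/
def HasCubeCoverings (K : Set (Space d)) (lam : ℕ → ℝ) (δ : ℝ) : Prop :=
  ∃ D : ℝ, 0 ≤ D ∧ ∀ ε : ℝ, 0 < ε → ∀ s : ℝ, 0 < s → ∀ (p : Space d) (U : Finset ℕ),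
    ∃ (I : Finset ℕ) (x : ℕ → Space d), Disjoint I U ∧
      cube p s ⊆ (⋃ i ∈ I, x i +ᵥ lam i • K) ∧
      (∀ i ∈ I, ((x i +ᵥ lam i • K) ∩ cube p s).Nonempty) ∧
      (δ - ε) * s ^ d ≤ ∑ i ∈ I, lam i ^ d * (volume K).toReal ∧
      ∑ i ∈ I, lam i ^ d * (volume K).toReal ≤ (δ + ε) * (s + D) ^ d

theorem exists_mem_vadd_smul {K : Set (Space d)} (hne : K.Nonempty) (r : ℝ) (y : Space d) :
    ∃ v : Space d, y ∈ v +ᵥ r • K := by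
  obtain ⟨k, hk⟩ := hne
  exact ⟨y - r • k, r • k, Set.smul_mem_smul_set hk, by simp⟩

theorem vadd_smul_subset_closedBall {K : Set (Space d)} {D : ℝ}
    (hKD : K ⊆ Metric.closedBall 0 D) {v y : Space d} {r M : ℝ} (hr : 0 ≤ r) (hrM : r ≤ M)
    (hy : y ∈ v +ᵥ r • K) : v +ᵥ r • K ⊆ Metric.closedBall y (2 * M * D) := by
  obtain ⟨_, ⟨k, hk, rfl⟩, rfl⟩ := hy
  rintro _ ⟨_, ⟨l, hl, rfl⟩, rfl⟩
  have h1 := hKD hk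
  have h2 := hKD hl
  rw [mem_closedBall_zero_iff] at h1 h2
  rw [Metric.mem_closedBall, dist_eq_norm]
  simp only [vadd_eq_add]
  have : v + r • l - (v + r • k) = r • (l - k) := by rw [smul_sub]; abel
  rw [this, norm_smul, Real.norm_of_nonneg hr]
  calc r * ‖l - k‖ ≤ M * (D + D) := by
        have h3 : ‖l - k‖ ≤ D + D := (norm_sub_le l k).trans (by linarith)
        exact mul_le_mul hrM h3 (norm_nonneg _) (hr.trans hrM)
    _ = 2 * M * D := by ring

theorem volume_body_eq_ofReal {K : Set (Space d)} (htop : volume K ≠ ⊤) (x : Space d) {r : ℝ}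
    (hr : 0 ≤ r) : volume (x +ᵥ r • K) = ENNReal.ofReal (r ^ d * (volume K).toReal) := by
  rw [volume_body K x hr, ENNReal.ofReal_mul (pow_nonneg hr d), ENNReal.ofReal_toReal htop]

theorem sum_volume_body {K : Set (Space d)} (htop : volume K ≠ ⊤) (x : ℕ → Space d) {lam : ℕ → ℝ}
    (hlam : ∀ i, 0 < lam i) (I : Finset ℕ) :
    ∑ i ∈ I, volume (x i +ᵥ lam i • K) =
      ENNReal.ofReal (∑ i ∈ I, lam i ^ d * (volume K).toReal) := by
  rw [ENNReal.ofReal_sum_of_nonneg fun i _ =>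
    mul_nonneg (pow_nonneg (hlam i).le d) ENNReal.toReal_nonneg]
  exact Finset.sum_congr rfl fun i _ => volume_body_eq_ofReal htop _ (hlam i).le

/-- The tiles of the shell tiling are enumerated and covered in turn, with ε = 1/(k+1) at tile k and
with the indices used so far excluded. Only finitely many tiles have a given size, so the sides tend
to infinity and the fixed boundary width `D₀` does not affect the limit. -/
theorem HasCubeCoverings.permitsCoveringOfDensity (hd : 1 ≤ d) {K : Set (Space d)}
    (hb : Bornology.IsBounded K) (hne : K.Nonempty) {lam : ℕ → ℝ} (hpos : ∀ i, 0 < lam i)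
    (hbdd : BddAbove (Set.range lam)) {δ : ℝ} (hδ : 0 ≤ δ) (h : HasCubeCoverings K lam δ) :
    PermitsCoveringOfDensity (fun i => lam i • K) (ENNReal.ofReal δ) := by
  classical
  obtain ⟨D₀, hD₀, hcube⟩ := h
  obtain ⟨M, hM⟩ := hbdd
  have hlamM : ∀ i, lam i ≤ M := fun i => hM ⟨i, rfl⟩
  have hM0 : 0 ≤ M := (hpos 0).le.trans (hlamM 0)
  obtain ⟨D₁, hD₁⟩ := hb.subset_closedBall 0
  obtain ⟨D, hD, hKD⟩ : ∃ D : ℝ, 0 ≤ D ∧ K ⊆ Metric.closedBall 0 D :=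
    ⟨max D₁ 0, le_max_right _ _, hD₁.trans (Metric.closedBall_subset_closedBall (le_max_left _ _))⟩
  have hKtop : volume K ≠ ⊤ := hb.measure_lt_top.ne
  set κ := (volume K).toReal with hκ
  have hκ0 : 0 ≤ κ := ENNReal.toReal_nonneg
  have := infinite_inShell hd
  obtain ⟨hden⟩ := nonempty_denumerable {q : ℕ × (Fin d → ℤ) // InShell q}
  let e : ℕ ≃ {q : ℕ × (Fin d → ℤ) // InShell q} := (Denumerable.eqv _).symm
  let s : ℕ → ℝ := fun k => 2 ^ (e k).1.1
  let p : ℕ → Space d := fun k => corner (s k) (e k).1.2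
  let Q : ℕ → Set (Space d) := fun k => cube (p k) (s k)
  let ρ : ℕ → ℝ := fun k => d * s k + 2 * M * D
  -- The term `M ^ d * κ` pays for body k, which is added at tile k if no tile has used it yet.
  let V : ℕ → ℝ := fun k => (δ + 1 / ((k : ℝ) + 1)) * (s k + D₀) ^ d + M ^ d * κ
  let W : ℕ → ℝ := fun k => (δ - 1 / ((k : ℝ) + 1)) * s k ^ d
  have hs : ∀ k, 0 < s k := fun k => by positivity
  have hshell := isSlowPacking_inShell (d := d) (R := 2 * M * D) (by positivity)
  have hpack : IsSlowPacking Q p ρ :=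
    { measurableSet := fun k => hshell.measurableSet (e k)
      disjoint := fun i j hij => hshell.disjoint (e.injective.ne hij)
      subset := fun k => hshell.subset (e k)
      slow := fun η hη => (hshell.slow η hη).preimage e.injective.injOn }
  have hQcov : ⋃ k, Q k = Set.univ := by
    refine Set.eq_univ_of_forall fun y => ?_
    obtain ⟨q, hq, hyq⟩ := exists_inShell y
    refine Set.mem_iUnion.2 ⟨e.symm ⟨q, hq⟩, ?_⟩
    simp only [Q, p, s, Equiv.apply_symm_apply]
    exact hyq
  have hs_lim : Tendsto s atTop atTop := by
    have h1 : Tendsto (fun k => (e k).1.1) atTop atTop := by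
      refine tendsto_atTop.2 fun N => ?_
      rw [← Nat.cofinite_eq_atTop, Filter.eventually_cofinite]
      refine ((finite_inShell_le N).preimage e.injective.injOn).subset ?_
      intro k hk
      exact (not_le.1 hk).le
    exact (tendsto_pow_atTop_atTop_of_one_lt (by norm_num)).comp h1
  let G : ℕ → Unit → Unit → Finset ℕ → (ℕ → Space d) → Prop := fun k _ _ I x =>
    Q k ⊆ (⋃ i ∈ I, x i +ᵥ lam i • K) ∧
    (∀ i ∈ I, ((x i +ᵥ lam i • K) ∩ Q k).Nonempty) ∧
    W k ≤ ∑ i ∈ I, lam i ^ d * κ ∧ ∑ i ∈ I, lam i ^ d * κ ≤ V k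
  have hcongr : ∀ k u u' I x x', (∀ i ∈ I, x i = x' i) → G k u u' I x → G k u u' I x' := by
    rintro k - - I x x' hxx ⟨h1, h2, h3⟩
    refine ⟨?_, ?_, h3⟩
    · intro y hy
      obtain ⟨i, hi, hyi⟩ := Set.mem_iUnion₂.1 (h1 hy)
      exact Set.mem_iUnion₂.2 ⟨i, hi, hxx i hi ▸ hyi⟩
    · intro i hi
      rw [← hxx i hi]
      exact h2 i hi
  have hstep : ∀ k U (u : Unit), ∃ I x u', Disjoint I U ∧ (k ∈ U ∨ k ∈ I) ∧ G k u u' I x := by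
    rintro k U -
    obtain ⟨I, x, hIU, hcov, hmeet, hlow, hup⟩ :=
      hcube (1 / ((k : ℝ) + 1)) (by positivity) (s k) (hs k) (p k) U
    by_cases hk : k ∈ U ∪ I
    · refine ⟨I, x, (), hIU, Finset.mem_union.1 hk, hcov, hmeet, hlow, hup.trans ?_⟩
      have : 0 ≤ M ^ d * κ := by positivity
      simp only [V]
      linarith
    · rw [Finset.mem_union, not_or] at hk
      obtain ⟨v, hv⟩ := exists_mem_vadd_smul hne (lam k) (p k)
      have hne' : ∀ i ∈ I, i ≠ k := by
        rintro i hi rfl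
        exact hk.2 hi
      refine ⟨insert k I, Function.update x k v, (), ?_, Or.inr (Finset.mem_insert_self _ _),
        ?_, ?_, ?_, ?_⟩
      · rw [Finset.disjoint_insert_left]
        exact ⟨hk.1, hIU⟩
      · intro y hy
        obtain ⟨i, hi, hyi⟩ := Set.mem_iUnion₂.1 (hcov hy)
        refine Set.mem_iUnion₂.2 ⟨i, Finset.mem_insert_of_mem hi, ?_⟩
        rwa [Function.update_of_ne (hne' i hi)]
      · intro i hi
        rcases Finset.mem_insert.1 hi with rfl | hi
        · rw [Function.update_self]
          exact ⟨p i, hv, self_mem_cube _ (hs i)⟩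
        · rw [Function.update_of_ne (hne' i hi)]
          exact hmeet i hi
      · rw [Finset.sum_insert hk.2]
        have : 0 ≤ lam k ^ d * κ := mul_nonneg (pow_nonneg (hpos k).le _) hκ0
        simp only [W]
        linarith
      · rw [Finset.sum_insert hk.2]
        have : lam k ^ d * κ ≤ M ^ d * κ := by
          have := pow_le_pow_left₀ (hpos k).le (hlamM k) d
          gcongr
        simp only [V]
        linarith
  obtain ⟨st, τ, P, x, -, hτ, hP⟩ := exists_partition_of_step hcongr () hstep
  have hpre : ∀ k, τ ⁻¹' {k} = (P k : Set ℕ) := by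
    intro k
    ext i
    rw [Set.mem_preimage, Set.mem_singleton_iff, hτ, Finset.mem_coe]
  have hfib : ∀ k, ∑' i : τ ⁻¹' {k}, volume (x i +ᵥ lam i • K) =
      ENNReal.ofReal (∑ i ∈ P k, lam i ^ d * κ) := by
    intro k
    rw [hpre k, Finset.tsum_subtype' (P k) (fun i => volume (x i +ᵥ lam i • K)),
      sum_volume_body hKtop x hpos]
  have hA : ∀ i, x i +ᵥ lam i • K ⊆ Metric.closedBall (p (τ i)) (ρ (τ i)) := by
    intro i
    obtain ⟨w, hwA, hwQ⟩ := (hP (τ i)).2.1 i ((hτ i _).1 rfl)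
    refine (vadd_smul_subset_closedBall hKD (hpos i).le (hlamM i) hwA).trans ?_
    refine Metric.closedBall_subset_closedBall' ?_
    have := cube_subset_closedBall _ (hs _).le hwQ
    rw [Metric.mem_closedBall] at this
    simp only [ρ]
    linarith
  have hs_inv : Tendsto (fun k => (s k)⁻¹) atTop (𝓝 0) := tendsto_inv_atTop_zero.comp hs_lim
  have hk_inv : Tendsto (fun k : ℕ => 1 / ((k : ℝ) + 1)) atTop (𝓝 0) :=
    tendsto_one_div_add_atTop_nhds_zero_nat
  have hVlim : Tendsto (fun k => V k / s k ^ d) atTop (𝓝 δ) := by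
    have h1 : ∀ k, V k / s k ^ d = (δ + 1 / ((k : ℝ) + 1)) * (1 + D₀ * (s k)⁻¹) ^ d +
        M ^ d * κ * ((s k)⁻¹) ^ d := by
      intro k
      have : s k + D₀ = s k * (1 + D₀ * (s k)⁻¹) := by
        rw [mul_add, mul_one, mul_comm D₀, mul_inv_cancel_left₀ (hs k).ne']
      simp only [V]
      rw [this, mul_pow, inv_pow]
      have := (pow_pos (hs k) d).ne'
      field_simp
    simp only [h1]
    have h2 : Tendsto (fun k : ℕ => (δ + 1 / ((k : ℝ) + 1)) * (1 + D₀ * (s k)⁻¹) ^ d +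
        M ^ d * κ * ((s k)⁻¹) ^ d) atTop (𝓝 ((δ + 0) * (1 + D₀ * 0) ^ d + M ^ d * κ * 0 ^ d)) :=
      (((hk_inv.const_add δ).mul (((hs_inv.const_mul D₀).const_add 1).pow d))).add
        ((hs_inv.pow d).const_mul _)
    have h3 : (0 : ℝ) ^ d = 0 := zero_pow (by omega)
    simpa [h3] using h2
  have hcover : CoversSpace (fun i => x i +ᵥ lam i • K) := by
    refine Set.eq_univ_of_forall fun y => ?_
    have hy : y ∈ ⋃ k, Q k := by rw [hQcov]; trivial
    obtain ⟨k, hk⟩ := Set.mem_iUnion.1 hy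
    obtain ⟨i, -, hi⟩ := Set.mem_iUnion₂.1 ((hP k).1 hk)
    exact Set.mem_iUnion.2 ⟨i, hi⟩
  have hvolQ : ∀ k, volume (Q k) = ENNReal.ofReal (s k ^ d) := fun k => volume_cube' _ (hs k).le
  have hupper : upperDensity (fun i => x i +ᵥ lam i • K) ≤ ENNReal.ofReal δ := by
    refine hpack.upperDensity_le hd (τ := τ) (V := fun k => ENNReal.ofReal (V k)) hA
      (fun _ => ENNReal.ofReal_ne_top) ?_ ENNReal.ofReal_ne_top ?_
    · intro k
      rw [hfib]
      exact ENNReal.ofReal_le_ofReal (hP k).2.2.2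
    · intro ε hε
      have hev : ∀ᶠ k in atTop, V k / s k ^ d < δ + ε := hVlim.eventually_lt_const (by linarith)
      rw [← Nat.cofinite_eq_atTop, Filter.eventually_cofinite] at hev
      refine hev.subset fun k hk hlt => ?_
      rw [Set.mem_ofPred_eq, hvolQ, ← ENNReal.ofReal_add hδ hε.le,
        ← ENNReal.ofReal_mul (by linarith)] at hk
      rw [div_lt_iff₀ (pow_pos (hs k) d)] at hlt
      exact absurd (ENNReal.ofReal_le_ofReal hlt.le) (not_le.2 hk)
  have hlower : ENNReal.ofReal δ ≤ lowerDensity (fun i => x i +ᵥ lam i • K) := by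
    refine hpack.le_lowerDensity hd hQcov (τ := τ) (V := fun k => ENNReal.ofReal (W k)) hA
      ?_ ENNReal.ofReal_ne_top ?_
    · intro k
      rw [hfib]
      exact ENNReal.ofReal_le_ofReal (hP k).2.2.1
    · intro ε hε
      have hev : ∀ᶠ k : ℕ in atTop, 1 / ((k : ℝ) + 1) < ε := hk_inv.eventually_lt_const hε
      rw [← Nat.cofinite_eq_atTop, Filter.eventually_cofinite] at hev
      refine hev.subset fun k hk hlt => ?_
      rw [Set.mem_ofPred_eq, hvolQ, ← ENNReal.ofReal_sub _ hε.le] at hk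
      refine absurd hk (not_lt.2 ?_)
      rcases le_or_gt (δ - ε) 0 with hneg | hp
      · rw [ENNReal.ofReal_of_nonpos hneg, zero_mul]
        exact zero_le
      · rw [← ENNReal.ofReal_mul hp.le]
        apply ENNReal.ofReal_le_ofReal
        have := (pow_pos (hs k) d).le
        simp only [W]
        gcongr
  have hle : lowerDensity (fun i => x i +ᵥ lam i • K) ≤
      upperDensity (fun i => x i +ᵥ lam i • K) :=
    lowerDensity_le_upperDensity fun i => (hne.smul_set).vadd_set
  exact ⟨x, hcover, le_antisymm (hle.trans hupper) hlower,
    le_antisymm hupper (hlower.trans hle)⟩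

end

/-! ### Sequences with a positive limit point -/

section

variable {d : ℕ}

theorem exists_cube_subset {K : Set (Space d)} (hint : (interior K).Nonempty) :
    ∃ (p : Space d) (a : ℝ), 0 < a ∧ cube p a ⊆ K := by
  obtain ⟨p, hp⟩ := hint
  obtain ⟨r, hr, hrK⟩ := Metric.isOpen_iff.1 isOpen_interior p hp
  refine ⟨p, r / (d + 1), by positivity, ?_⟩
  refine (cube_subset_closedBall p (by positivity)).trans ?_
  refine (Metric.closedBall_subset_ball ?_).trans (hrK.trans interior_subset)
  rw [mul_div_assoc', div_lt_iff₀ (by positivity)]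
  nlinarith

theorem coveringDensity_ne_top (hd : 1 ≤ d) {K : Set (Space d)} (hb : Bornology.IsBounded K)
    (hint : (interior K).Nonempty) : coveringDensity K ≠ ⊤ := by
  obtain ⟨p, a, ha, hpK⟩ := exists_cube_subset hint
  have hX : cube 0 a ⊆ ⋃ x ∈ ({-p} : Finset (Space d)), x +ᵥ K := by
    simp only [Finset.mem_singleton, Set.iUnion_iUnion_eq_left]
    calc cube 0 a = -p +ᵥ cube p a := by rw [vadd_cube, neg_add_cancel]
      _ ⊆ -p +ᵥ K := Set.vadd_set_mono hpK
  refine ne_top_of_le_ne_top ?_ (coveringDensity_le hd hb (hint.mono interior_subset) ha hX)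
  refine ENNReal.div_ne_top (ENNReal.mul_ne_top (ENNReal.natCast_ne_top _) hb.measure_lt_top.ne) ?_
  rw [Ne, ENNReal.ofReal_eq_zero, not_le]
  positivity

theorem coveringDensity_toReal_mul_le (hd : 1 ≤ d) {K : Set (Space d)}
    (hb : Bornology.IsBounded K) (hne : K.Nonempty) {s : ℝ} (hs : 0 < s) {X : Finset (Space d)}
    (hX : cube 0 s ⊆ ⋃ x ∈ X, x +ᵥ K) :
    (coveringDensity K).toReal * s ^ d ≤ X.card * (volume K).toReal := by
  have hpow : 0 < s ^ d := by positivity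
  have h1 := coveringDensity_le hd hb hne hs hX
  have h2 : ENNReal.ofReal (s ^ d) ≠ 0 := by
    rw [Ne, ENNReal.ofReal_eq_zero, not_le]
    exact hpow
  have h3 := ENNReal.toReal_mono (ENNReal.div_ne_top (ENNReal.mul_ne_top
    (ENNReal.natCast_ne_top X.card) hb.measure_lt_top.ne) h2) h1
  rw [ENNReal.toReal_div, ENNReal.toReal_mul, ENNReal.toReal_natCast,
    ENNReal.toReal_ofReal hpow.le, le_div_iff₀ hpow] at h3
  exact h3

/-- Infinitely many bodies lie, up to translation, between μK and νK with ν/μ close to 1. An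
economical covering by translates of μK bounds the cost from above; replacing the bodies by
translates of νK bounds it from below by the covering density. -/
theorem hasCubeCoverings_of_mapClusterPt (hd : 1 ≤ d) {K : Set (Space d)} (hconv : Convex ℝ K)
    (hb : Bornology.IsBounded K) (hint : (interior K).Nonempty) {lam : ℕ → ℝ} {c : ℝ}
    (hpos : ∀ i, 0 < lam i) (hc : 0 < c) (hcl : MapClusterPt c atTop lam) :
    HasCubeCoverings K lam (coveringDensity K).toReal := by
  classical
  have hne : K.Nonempty := hint.mono interior_subset
  have htop := coveringDensity_ne_top hd hb hint
  have hKtop : volume K ≠ ⊤ := hb.measure_lt_top.ne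
  have hK0 : volume K ≠ 0 :=
    ((isOpen_interior.measure_pos volume hint).trans_le (measure_mono interior_subset)).ne'
  obtain ⟨D₁, hD₁⟩ := hb.subset_closedBall 0
  obtain ⟨D, hD, hKD⟩ : ∃ D : ℝ, 0 ≤ D ∧ K ⊆ Metric.closedBall 0 D :=
    ⟨max D₁ 0, le_max_right _ _, hD₁.trans (Metric.closedBall_subset_closedBall (le_max_left _ _))⟩
  set θ := (coveringDensity K).toReal with hθ
  have hθ0 : 0 ≤ θ := ENNReal.toReal_nonneg
  set κ := (volume K).toReal with hκ
  have hκ0 : 0 ≤ κ := ENNReal.toReal_nonneg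
  -- The boundary width 2D of `exists_cover_cube` is scaled by μ ≤ c, so 2Dc serves for all ε and s.
  refine ⟨2 * D * c, by positivity, fun ε hε s hs p U => ?_⟩
  obtain ⟨η, h0, h1, hη1, hη2⟩ : ∃ η : ℝ, 0 < η ∧ η < 1 ∧
      (θ + ε / 2) * ((1 + η) / (1 - η)) ^ d < θ + ε ∧
      (θ - ε) * ((1 + η) / (1 - η)) ^ d < θ := by
    have e1 := (tendsto_shrink_pow d).const_mul (θ + ε / 2)
    have e2 := (tendsto_shrink_pow d).const_mul (θ - ε)
    rw [mul_one] at e1 e2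
    have e3 : ∀ᶠ η : ℝ in 𝓝[>] 0, η ∈ Set.Ioo (0 : ℝ) 1 := Ioo_mem_nhdsGT (zero_lt_one' ℝ)
    obtain ⟨η, ⟨⟨h0, h1⟩, h2⟩, h3⟩ := ((e3.and
      (e1.eventually_lt_const (by linarith : θ + ε / 2 < θ + ε))).and
      (e2.eventually_lt_const (by linarith : θ - ε < θ))).exists
    exact ⟨η, h0, h1, h2, h3⟩
  set μ : ℝ := c * (1 - η) with hμ
  set ν : ℝ := c * (1 + η) with hν
  have hμ0 : 0 < μ := mul_pos hc (by linarith)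
  have hν0 : 0 < ν := mul_pos hc (by linarith)
  have hνμ : (1 + η) / (1 - η) = ν / μ := by
    rw [hμ, hν, mul_div_mul_left _ _ hc.ne']
  rw [hνμ] at hη1 hη2
  obtain ⟨X, hXcov, hXcard⟩ := exists_cover_cube hd hD hKD hK0 htop (s := s / μ) (ε := ε / 2)
    (by positivity) (by positivity)
  have hXcard' : X.card * κ ≤ (θ + ε / 2) * (s / μ + 2 * D) ^ d := by
    have := ENNReal.toReal_mono (ENNReal.mul_ne_top
      (ENNReal.add_ne_top.2 ⟨htop, ENNReal.ofReal_ne_top⟩) ENNReal.ofReal_ne_top) hXcard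
    rwa [ENNReal.toReal_mul, ENNReal.toReal_natCast, ENNReal.toReal_mul,
      ENNReal.toReal_add htop ENNReal.ofReal_ne_top, ENNReal.toReal_ofReal (by positivity),
      ENNReal.toReal_ofReal (by positivity)] at this
  have hinf : {i | μ ≤ lam i ∧ lam i ≤ ν}.Infinite := by
    rw [← Nat.frequently_atTop_iff_infinite]
    refine hcl.frequently (p := fun x => μ ≤ x ∧ x ≤ ν) ?_
    refine Icc_mem_nhds ?_ ?_
    · rw [hμ]; nlinarith
    · rw [hν]; nlinarith
  obtain ⟨I, hIsub, hIcard⟩ := (hinf.sdiff U.finite_toSet).exists_subset_card_eq X.card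
  have hI1 : ∀ i ∈ I, μ ≤ lam i ∧ lam i ≤ ν := fun i hi => (hIsub hi).1
  have hIU : Disjoint I U := Finset.disjoint_left.2 fun i hi => (hIsub hi).2
  let g := Finset.equivOfCardEq hIcard
  have hv : ∀ i : I, ∃ v : Space d, v +ᵥ μ • K ⊆ lam i • K := fun i =>
    exists_vadd_smul_subset hconv hne hμ0.le (hI1 i i.2).1
  choose v hv using hv
  -- Subtracting `v` puts the copy of μK inside body i exactly where the scaled covering needs it.
  let x : ℕ → Space d := fun i => if h : i ∈ I then p + μ • (g ⟨i, h⟩ : Space d) - v ⟨i, h⟩ else 0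
  have hcov : cube p s ⊆ ⋃ i ∈ I, x i +ᵥ lam i • K := by
    intro y hy
    have hy' : μ⁻¹ • (y - p) ∈ cube (0 : Space d) (s / μ) := by
      intro j
      have := hy j
      rw [PiLp.smul_apply, PiLp.sub_apply, PiLp.zero_apply, smul_eq_mul, zero_add,
        div_eq_inv_mul]
      have hinv : 0 < μ⁻¹ := inv_pos.2 hμ0
      exact ⟨mul_nonneg hinv.le (by linarith [this.1]),
        mul_lt_mul_of_pos_left (by linarith [this.2]) hinv⟩
    obtain ⟨ξ, hξ, k, hk, hξk⟩ := Set.mem_iUnion₂.1 (hXcov hy')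
    simp only [vadd_eq_add] at hξk
    set i := g.symm ⟨ξ, hξ⟩ with hi
    have hgi : (g i : Space d) = ξ := by rw [hi, Equiv.apply_symm_apply]
    refine Set.mem_iUnion₂.2 ⟨i, i.2, v i + μ • k,
      hv i ⟨μ • k, Set.smul_mem_smul_set hk, rfl⟩, ?_⟩
    have hx : x i = p + μ • ξ - v i := by
      simp only [x]
      rw [dif_pos i.2]
      simp only [Subtype.coe_eta, hgi]
    have hyk : y = p + (μ • ξ + μ • k) := by
      rw [← smul_add, hξk, smul_inv_smul₀ hμ0.ne']
      abel
    simp only [vadd_eq_add]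
    rw [hx, hyk]
    abel
  set I' := I.filter (fun i => ((x i +ᵥ lam i • K) ∩ cube p s).Nonempty) with hI'
  have hcov' : cube p s ⊆ ⋃ i ∈ I', x i +ᵥ lam i • K := by
    intro y hy
    obtain ⟨i, hi, hyi⟩ := Set.mem_iUnion₂.1 (hcov hy)
    exact Set.mem_iUnion₂.2 ⟨i, Finset.mem_filter.2 ⟨hi, y, hyi, hy⟩, hyi⟩
  refine ⟨I', x, Finset.disjoint_of_subset_left (Finset.filter_subset _ _) hIU, hcov',
    fun i hi => (Finset.mem_filter.1 hi).2, ?_, ?_⟩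
  · have hw : ∀ i ∈ I', ∃ w : Space d, w +ᵥ lam i • K ⊆ ν • K := fun i hi =>
      exists_vadd_smul_subset hconv hne (hpos i).le (hI1 i (Finset.mem_filter.1 hi).1).2
    choose! w hw using hw
    -- Enlarged to ratio ν and rescaled by 1/ν, the bodies become translates of K covering a cube of
    -- side s/ν. Coinciding translates only reduce the cardinality, which is harmless for a lower
    -- bound on |I'|.
    set X' : Finset (Space d) := I'.image fun i => ν⁻¹ • (x i - w i - p) with hX'
    have hX'cov : cube 0 (s / ν) ⊆ ⋃ ξ ∈ X', ξ +ᵥ K := by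
      intro y hy
      have hy' : p + ν • y ∈ cube p s := by
        intro j
        have := hy j
        rw [PiLp.zero_apply, zero_add, lt_div_iff₀ hν0] at this
        rw [PiLp.add_apply, PiLp.smul_apply, smul_eq_mul]
        have h3 := mul_nonneg hν0.le this.1
        constructor <;> linarith [this.2]
      obtain ⟨i, hi, l, hl, hil⟩ := Set.mem_iUnion₂.1 (hcov' hy')
      obtain ⟨k, hk, hkl⟩ := hw i hi ⟨l, hl, rfl⟩
      refine Set.mem_iUnion₂.2 ⟨_, Finset.mem_image_of_mem _ hi, k, hk, ?_⟩
      simp only [vadd_eq_add] at hil hkl ⊢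
      have e1 : k = ν⁻¹ • (w i + l) := by rw [← hkl, inv_smul_smul₀ hν0.ne']
      rw [e1, ← smul_add, inv_smul_eq_iff₀ hν0.ne']
      have e2 : ν • y = x i + l - p := by rw [hil]; abel
      rw [e2]
      abel
    have e1 := coveringDensity_toReal_mul_le hd hb hne (by positivity) hX'cov
    have e2 : (X'.card : ℝ) ≤ I'.card := by exact_mod_cast Finset.card_image_le
    have e3 : θ * (s / ν) ^ d ≤ I'.card * κ := e1.trans (by gcongr)
    calc (θ - ε) * s ^ d = ((θ - ε) * (ν / μ) ^ d) * (s / ν) ^ d * μ ^ d := by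
          rw [mul_assoc, mul_assoc, ← mul_assoc ((ν / μ) ^ d), ← mul_pow, ← mul_pow]
          congr 2
          field_simp
      _ ≤ θ * (s / ν) ^ d * μ ^ d := by gcongr
      _ ≤ I'.card * κ * μ ^ d := by gcongr
      _ = ∑ _i ∈ I', μ ^ d * κ := by rw [Finset.sum_const, nsmul_eq_mul]; ring
      _ ≤ ∑ i ∈ I', lam i ^ d * κ := by
          gcongr with i hi
          exact (hI1 i (Finset.mem_filter.1 hi).1).1
  · calc ∑ i ∈ I', lam i ^ d * κ ≤ ∑ i ∈ I, lam i ^ d * κ := by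
          refine Finset.sum_le_sum_of_subset_of_nonneg (Finset.filter_subset _ _) ?_
          intro i _ _
          exact mul_nonneg (pow_nonneg (hpos i).le d) hκ0
      _ ≤ ∑ _i ∈ I, ν ^ d * κ := by
          gcongr with i hi
          · exact (hpos i).le
          · exact (hI1 i hi).2
      _ = X.card * κ * ν ^ d := by rw [Finset.sum_const, nsmul_eq_mul, hIcard]; ring
      _ ≤ (θ + ε / 2) * (s / μ + 2 * D) ^ d * ν ^ d := by gcongr
      _ = ((θ + ε / 2) * (ν / μ) ^ d) * (s + 2 * D * μ) ^ d := by
          rw [mul_assoc, mul_assoc, ← mul_pow, ← mul_pow]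
          congr 2
          field_simp
      _ ≤ (θ + ε) * (s + 2 * D * c) ^ d := by
          have : μ ≤ c := by rw [hμ]; nlinarith
          gcongr

end

/-! ### Dyadic arrangements and covering at bounded cost -/

section

variable {d : ℕ}

theorem exists_child {h : ℝ} (hh : 0 < h) {z : Fin d → ℤ} {x : Space d} (hx : x ∈ cell h z) :
    ∃ b : Fin d → Fin 2, x ∈ cell (h / 2) (fun j => 2 * z j + (b j : ℕ)) := by
  have hfl := (mem_cell hh).1 hx
  have hdiv : ∀ j, x j / (h / 2) = 2 * (x j / h) := fun j => by field_simp
  refine ⟨fun j => if 2 * (x j / h) < 2 * z j + 1 then 0 else 1, (mem_cell (by positivity)).2 fun j => ?_⟩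
  have h1 := Int.floor_eq_iff.1 (hfl j)
  rw [hdiv, Int.floor_eq_iff]
  beta_reduce
  split_ifs with hlt
  · push_cast
    simp only [Fin.val_zero, Nat.cast_zero]
    constructor <;> linarith [h1.1, h1.2]
  · push_cast
    simp only [Fin.val_one, Nat.cast_one]
    constructor <;> linarith [h1.1, h1.2]

/-- Dyadic cells of given sizes, of sufficient total volume, can be arranged to cover a given
set of cells which are at least as large, without waste. -/
theorem exists_dyadic_arrangement {s : ℝ} (hs : 0 < s) (k : ℕ → ℕ) (m : ℕ) :
    ∀ (n : ℕ) (F : Finset ℕ), (∀ i ∈ F, n ≤ k i ∧ k i < n + m) → ∀ Z : Finset (Fin d → ℤ),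
      Z.card * ((1 / 2 : ℝ) ^ d) ^ n ≤ ∑ i ∈ F, ((1 / 2 : ℝ) ^ d) ^ k i →
      ∃ I ⊆ F, ∃ z : ℕ → Fin d → ℤ,
        (⋃ w ∈ Z, cell (s / 2 ^ n) w) ⊆ (⋃ i ∈ I, cell (s / 2 ^ k i) (z i)) ∧
        ∑ i ∈ I, ((1 / 2 : ℝ) ^ d) ^ k i ≤ Z.card * ((1 / 2 : ℝ) ^ d) ^ n := by
  classical
  set u : ℝ := (1 / 2 : ℝ) ^ d with hu
  have hu0 : 0 < u := by positivity
  induction m with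
  | zero =>
    intro n F hF Z hZ
    have hF0 : F = ∅ := Finset.eq_empty_of_forall_notMem fun i hi => by
      have := hF i hi
      omega
    rw [hF0, Finset.sum_empty] at hZ
    have hZ0 : Z = ∅ := by
      rw [← Finset.card_eq_zero]
      by_contra hne
      have : (0 : ℝ) < Z.card := by exact_mod_cast Nat.pos_of_ne_zero hne
      have := mul_pos this (pow_pos hu0 n)
      linarith
    refine ⟨∅, by simp, fun _ _ => 0, ?_⟩
    simp [hZ0]
  | succ m ih =>
    intro n F hF Z hZ
    set F₀ := F.filter (fun i => k i = n) with hF₀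
    set F₁ := F.filter (fun i => ¬ k i = n) with hF₁
    have hk₀ : ∀ i ∈ F₀, k i = n := fun i hi => (Finset.mem_filter.1 hi).2
    -- Greedy choice, largest cubes first: either the cubes of the current size suffice for Z, or
    -- all of them are used and each remaining cell is split into 2^d children for the smaller
    -- cubes.
    rcases le_or_gt Z.card F₀.card with hle | hlt
    · obtain ⟨I, hIF, hIcard⟩ := Finset.exists_subset_card_eq hle
      let g := Finset.equivOfCardEq hIcard
      refine ⟨I, hIF.trans (Finset.filter_subset _ _),
        fun i => if h : i ∈ I then (g ⟨i, h⟩ : Fin d → ℤ) else 0, ?_, ?_⟩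
      · refine Set.iUnion₂_subset fun w hw y hy => ?_
        set i := g.symm ⟨w, hw⟩ with hi
        have hgi : (g i : Fin d → ℤ) = w := by rw [hi, Equiv.apply_symm_apply]
        refine Set.mem_iUnion₂.2 ⟨i, i.2, ?_⟩
        beta_reduce
        rw [dif_pos i.2, hk₀ i (hIF i.2)]
        simpa only [Subtype.coe_eta, hgi] using hy
      · rw [Finset.sum_congr rfl fun i hi => by rw [hk₀ i (hIF hi)], Finset.sum_const,
          nsmul_eq_mul, hIcard]
    · obtain ⟨Z₀, hZ₀Z, hZ₀card⟩ := Finset.exists_subset_card_eq hlt.le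
      let g := Finset.equivOfCardEq hZ₀card.symm
      set Z₂ : Finset (Fin d → ℤ) := ((Z \ Z₀) ×ˢ (Finset.univ : Finset (Fin d → Fin 2))).image
        (fun q j => 2 * q.1 j + ((q.2 j : ℕ) : ℤ)) with hZ₂
      have hcard : ((Z \ Z₀).card : ℝ) = Z.card - F₀.card := by
        rw [Finset.card_sdiff_of_subset hZ₀Z, Nat.cast_sub (Finset.card_le_card hZ₀Z), hZ₀card]
      have hZ₂card : (Z₂.card : ℝ) * u ^ (n + 1) ≤ (Z \ Z₀).card * u ^ n := by
        have h1 : Z₂.card ≤ (Z \ Z₀).card * 2 ^ d := by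
          refine Finset.card_image_le.trans ?_
          rw [Finset.card_product]
          simp
        have h2 : (Z₂.card : ℝ) ≤ (Z \ Z₀).card * 2 ^ d := by exact_mod_cast h1
        calc (Z₂.card : ℝ) * u ^ (n + 1) ≤ ((Z \ Z₀).card * 2 ^ d) * u ^ (n + 1) := by gcongr
          _ = (Z \ Z₀).card * u ^ n * (2 ^ d * u) := by ring
          _ = _ := by
            rw [hu, ← mul_pow]
            norm_num
      have hsplit : ∑ i ∈ F, u ^ k i = F₀.card * u ^ n + ∑ i ∈ F₁, u ^ k i := by
        rw [← Finset.sum_filter_add_sum_filter_not F (fun i => k i = n)]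
        congr 1
        rw [Finset.sum_congr rfl fun i hi => by rw [hk₀ i hi], Finset.sum_const, nsmul_eq_mul]
      obtain ⟨I₁, hI₁, z₁, hcov₁, hsum₁⟩ := ih (n + 1) F₁ (fun i hi => by
        have h1 := Finset.mem_filter.1 hi
        have h2 := hF i h1.1
        have h3 := h1.2
        omega) Z₂ (by
          rw [hsplit] at hZ
          rw [hcard] at hZ₂card
          linarith)
      have hdisj : ∀ i ∈ I₁, i ∉ F₀ := fun i hi hi0 =>
        (Finset.mem_filter.1 (hI₁ hi)).2 (hk₀ i hi0)
      refine ⟨F₀ ∪ I₁, Finset.union_subset (Finset.filter_subset _ _)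
        (hI₁.trans (Finset.filter_subset _ _)),
        fun i => if h : i ∈ F₀ then (g ⟨i, h⟩ : Fin d → ℤ) else z₁ i, ?_, ?_⟩
      · refine Set.iUnion₂_subset fun w hw y hy => ?_
        by_cases hw0 : w ∈ Z₀
        · set i := g.symm ⟨w, hw0⟩ with hi
          have hgi : (g i : Fin d → ℤ) = w := by rw [hi, Equiv.apply_symm_apply]
          refine Set.mem_iUnion₂.2 ⟨i, Finset.mem_union_left _ i.2, ?_⟩
          beta_reduce
          rw [dif_pos i.2, hk₀ i i.2]
          simpa only [Subtype.coe_eta, hgi] using hy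
        · obtain ⟨b, hb⟩ := exists_child (by positivity) hy
          have hmem : (fun j => 2 * w j + ((b j : ℕ) : ℤ)) ∈ Z₂ :=
            Finset.mem_image.2 ⟨(w, b), by simp [hw, hw0], rfl⟩
          rw [div_div, ← pow_succ] at hb
          obtain ⟨i, hi, hyi⟩ := Set.mem_iUnion₂.1 (hcov₁ (Set.mem_iUnion₂.2 ⟨_, hmem, hb⟩))
          refine Set.mem_iUnion₂.2 ⟨i, Finset.mem_union_right _ hi, ?_⟩
          beta_reduce
          rwa [dif_neg (hdisj i hi)]
      · rw [Finset.sum_union (Finset.disjoint_left.2 fun i h0 h1 => hdisj i h1 h0),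
          Finset.sum_congr rfl fun i hi => by rw [hk₀ i hi], Finset.sum_const, nsmul_eq_mul]
        rw [hcard] at hZ₂card
        linarith

/-- Dyadic cubes of total volume at least that of a cube, none of them larger than the cube, can
be arranged to cover the cube without waste. -/
theorem exists_dyadic_cover {s : ℝ} (hs : 0 < s) (k : ℕ → ℕ) {F : Finset ℕ}
    (hF : s ^ d ≤ ∑ i ∈ F, (s / 2 ^ k i) ^ d) :
    ∃ I ⊆ F, ∃ z : ℕ → Fin d → ℤ,
      cube 0 s ⊆ (⋃ i ∈ I, cell (s / 2 ^ k i) (z i)) ∧ ∑ i ∈ I, (s / 2 ^ k i) ^ d ≤ s ^ d := by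
  have hpow : ∀ i, (s / 2 ^ k i) ^ d = s ^ d * ((1 / 2 : ℝ) ^ d) ^ k i := by
    intro i
    rw [← pow_mul, mul_comm d, pow_mul, ← mul_pow, one_div, inv_pow, div_eq_mul_inv]
  have hsd : 0 < s ^ d := by positivity
  simp only [hpow, ← Finset.mul_sum] at hF ⊢
  obtain ⟨I, hI, z, hcov, hsum⟩ := exists_dyadic_arrangement hs k (F.sup k + 1) 0 F
    (fun i hi => ⟨Nat.zero_le _, by
      have := Finset.le_sup (f := k) hi
      omega⟩) {0} (by
      simp only [Finset.card_singleton, Nat.cast_one, pow_zero, mul_one]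
      exact le_of_mul_le_mul_left (by linarith) hsd)
  refine ⟨I, hI, z, ?_, ?_⟩
  · refine Set.Subset.trans ?_ hcov
    simp only [Finset.mem_singleton, Set.iUnion_iUnion_eq_left, pow_zero, div_one, cell]
    have : corner s (0 : Fin d → ℤ) = 0 := by ext j; simp
    rw [this]
  · simp only [Finset.card_singleton, Nat.cast_one, pow_zero, mul_one] at hsum
    nlinarith

/-- The set `S` can be covered by translates of sets `lam i • K`, at total volume at most `v`,
avoiding any given finite set of indices. -/
def CoverableAtCost (K : Set (Space d)) (lam : ℕ → ℝ) (S : Set (Space d)) (v : ℝ) : Prop :=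
  ∀ U : Finset ℕ, ∃ (I : Finset ℕ) (x : ℕ → Space d), Disjoint I U ∧
    S ⊆ (⋃ i ∈ I, x i +ᵥ lam i • K) ∧ ∑ i ∈ I, lam i ^ d * (volume K).toReal ≤ v

variable {K : Set (Space d)} {lam : ℕ → ℝ}

theorem CoverableAtCost.mono {S S' : Set (Space d)} {v v' : ℝ} (h : CoverableAtCost K lam S v)
    (hS : S' ⊆ S) (hv : v ≤ v') : CoverableAtCost K lam S' v' := by
  intro U
  obtain ⟨I, x, h1, h2, h3⟩ := h U
  exact ⟨I, x, h1, hS.trans h2, h3.trans hv⟩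

theorem biUnion_piecewise_subset {I I' : Finset ℕ} [DecidableEq ℕ] (h : Disjoint I' I)
    (x x' : ℕ → Space d) :
    (⋃ i ∈ I, x i +ᵥ lam i • K) ∪ (⋃ i ∈ I', x' i +ᵥ lam i • K) ⊆
      ⋃ i ∈ I ∪ I', (if i ∈ I then x i else x' i) +ᵥ lam i • K := by
  rintro y (hy | hy)
  · obtain ⟨i, hi, hyi⟩ := Set.mem_iUnion₂.1 hy
    refine Set.mem_iUnion₂.2 ⟨i, Finset.mem_union_left _ hi, ?_⟩
    rwa [if_pos hi]
  · obtain ⟨i, hi, hyi⟩ := Set.mem_iUnion₂.1 hy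
    refine Set.mem_iUnion₂.2 ⟨i, Finset.mem_union_right _ hi, ?_⟩
    rwa [if_neg (Finset.disjoint_left.1 h hi)]

theorem CoverableAtCost.union {S S' : Set (Space d)} {v v' : ℝ} (h : CoverableAtCost K lam S v)
    (h' : CoverableAtCost K lam S' v') : CoverableAtCost K lam (S ∪ S') (v + v') := by
  intro U
  obtain ⟨I, x, h1, h2, h3⟩ := h U
  obtain ⟨I', x', h1', h2', h3'⟩ := h' (U ∪ I)
  rw [Finset.disjoint_union_right] at h1'
  refine ⟨I ∪ I', fun i => if i ∈ I then x i else x' i, Finset.disjoint_union_left.2 ⟨h1, h1'.1⟩,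
    (Set.union_subset_union h2 h2').trans (biUnion_piecewise_subset h1'.2 x x'), ?_⟩
  rw [Finset.sum_union h1'.2.symm]
  linarith

theorem CoverableAtCost.biUnion {β : Type*} (T : Finset β) {S : β → Set (Space d)} {v : β → ℝ}
    (h : ∀ t ∈ T, CoverableAtCost K lam (S t) (v t)) :
    CoverableAtCost K lam (⋃ t ∈ T, S t) (∑ t ∈ T, v t) := by
  classical
  induction T using Finset.induction_on with
  | empty => exact fun U => ⟨∅, fun _ => 0, by simp⟩
  | insert t T ht ih =>
    rw [Finset.set_biUnion_insert, Finset.sum_insert ht]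
    exact (h t (Finset.mem_insert_self _ _)).union
      (ih fun t' ht' => h t' (Finset.mem_insert_of_mem ht'))

theorem CoverableAtCost.vadd {S : Set (Space d)} {v : ℝ} (h : CoverableAtCost K lam S v)
    (t : Space d) : CoverableAtCost K lam (t +ᵥ S) v := by
  intro U
  obtain ⟨I, x, h1, h2, h3⟩ := h U
  refine ⟨I, fun i => t + x i, h1, ?_, h3⟩
  rintro _ ⟨y, hy, rfl⟩
  obtain ⟨i, hi, l, hl, hil⟩ := Set.mem_iUnion₂.1 (h2 hy)
  refine Set.mem_iUnion₂.2 ⟨i, hi, l, hl, ?_⟩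
  simp only [vadd_eq_add] at hil ⊢
  rw [← hil, add_assoc]

/-- All cubes can be covered at cost `c` per unit of volume. -/
def CubesCoverableAtCost (K : Set (Space d)) (lam : ℕ → ℝ) (c : ℝ) : Prop :=
  ∀ s : ℝ, 0 < s → CoverableAtCost K lam (cube 0 s) (c * s ^ d)

/-- The set is covered by equal grid cells of total volume at most v, and each cell is paid for at
cost c. The strict inequality provides the room for the grid. -/
theorem CubesCoverableAtCost.compact {c : ℝ} (h : CubesCoverableAtCost K lam c) (hc : 0 ≤ c)
    {C : Set (Space d)} (hC : IsCompact C) {v : ℝ} (hv : volume C < ENNReal.ofReal v) :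
    CoverableAtCost K lam C (c * v) := by
  have hv0 : 0 < v := ENNReal.ofReal_pos.1 (zero_le.trans_lt hv)
  obtain ⟨t, ht, Z, hCZ, hZ⟩ := exists_cells_cover_compact hC hv
  have hcell : ∀ z ∈ Z, CoverableAtCost K lam (cell t z) (c * t ^ d) := by
    intro z _
    have := (h t ht).vadd (corner t z)
    rwa [vadd_cube, add_zero] at this
  refine (CoverableAtCost.biUnion Z hcell).mono hCZ ?_
  have hZ' : Z.card * t ^ d ≤ v := by
    rw [← ENNReal.ofReal_natCast, ← ENNReal.ofReal_mul (Nat.cast_nonneg _)] at hZ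
    exact (ENNReal.ofReal_le_ofReal_iff hv0.le).1 hZ
  rw [Finset.sum_const, nsmul_eq_mul]
  nlinarith

theorem exists_disjoint_le_sum {f : ℕ → ℝ} (hf : ∀ i, 0 ≤ f i) (hsum : ¬ Summable f)
    (U : Finset ℕ) (B : ℝ) : ∃ F : Finset ℕ, Disjoint F U ∧ B ≤ ∑ i ∈ F, f i := by
  by_contra hcon
  push Not at hcon
  refine hsum (summable_of_sum_le (c := B + ∑ i ∈ U, f i) hf fun F => ?_)
  have h1 := hcon (F \ U) Finset.sdiff_disjoint
  calc ∑ i ∈ F, f i ≤ ∑ i ∈ (F \ U) ∪ U, f i :=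
        Finset.sum_le_sum_of_subset_of_nonneg (fun i hi => by
          by_cases h : i ∈ U <;> simp [hi, h]) fun i _ _ => hf i
    _ = ∑ i ∈ F \ U, f i + ∑ i ∈ U, f i := Finset.sum_union Finset.sdiff_disjoint
    _ ≤ _ := by linarith

theorem exists_finset_small {lam : ℕ → ℝ} (hlim : Tendsto lam atTop (𝓝 0)) {δ : ℝ} (hδ : 0 < δ) :
    ∃ U : Finset ℕ, ∀ i, i ∉ U → lam i < δ := by
  have h := hlim.eventually_lt_const hδ
  rw [← Nat.cofinite_eq_atTop, Filter.eventually_cofinite] at h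
  refine ⟨h.toFinset, fun i hi => ?_⟩
  simpa using hi

theorem exists_dyadic_near {s t : ℝ} (hs : 0 < s) (ht : 0 < t) (hts : t ≤ s) :
    ∃ n : ℕ, s / 2 ^ (n + 1) ≤ t ∧ t ≤ s / 2 ^ n := by
  obtain ⟨n, h1, h2⟩ := exists_nat_pow_near_of_lt_one (x := t / s) (y := 1 / 2) (by positivity)
    ((div_le_one hs).2 hts) (by norm_num) (by norm_num)
  refine ⟨n, ?_, ?_⟩
  · rw [lt_div_iff₀ hs, one_div, inv_pow] at h1
    rw [div_eq_inv_mul]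
    exact h1.le
  · rw [div_le_iff₀ hs, one_div, inv_pow] at h2
    rw [div_eq_inv_mul]
    exact h2

/-- Each body contains a cube of side lam i * a, which is rounded down to a dyadic fraction of s at
the loss of a factor of at most 2. Divergence supplies enough of these cubes to cover the cube of
side s without waste, at cost at most (2/a)^d vol K per unit. -/
theorem exists_cubesCoverableAtCost (hint : (interior K).Nonempty) (hpos : ∀ i, 0 < lam i)
    (hlim : Tendsto lam atTop (𝓝 0)) (hsum : ¬ Summable fun i => lam i ^ d) :
    ∃ c, CubesCoverableAtCost K lam c := by
  classical
  obtain ⟨p, a, ha, hpK⟩ := exists_cube_subset hint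
  set κ := (volume K).toReal with hκ
  have hκ0 : 0 ≤ κ := ENNReal.toReal_nonneg
  refine ⟨(2 / a) ^ d * κ, fun s hs U => ?_⟩
  obtain ⟨U₀, hU₀⟩ := exists_finset_small hlim (show 0 < s / a by positivity)
  -- The finitely many large bodies get the exponent 0, which is never used because F avoids `U₀`.
  have hk : ∀ i, ∃ n : ℕ, i ∉ U₀ → s / 2 ^ n ≤ lam i * a ∧ lam i * a ≤ 2 * (s / 2 ^ n) := by
    intro i
    by_cases hi : i ∈ U₀
    · exact ⟨0, fun h => absurd hi h⟩
    · obtain ⟨n, h1, h2⟩ := exists_dyadic_near hs (mul_pos (hpos i) ha)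
        ((lt_div_iff₀ ha).1 (hU₀ i hi)).le
      refine ⟨n + 1, fun _ => ⟨h1, h2.trans (le_of_eq ?_)⟩⟩
      rw [pow_succ]
      field_simp
  choose k hk using hk
  obtain ⟨F, hFU, hF⟩ := exists_disjoint_le_sum (fun i => pow_nonneg (hpos i).le d) hsum (U ∪ U₀)
    ((2 / a * s) ^ d)
  rw [Finset.disjoint_union_right] at hFU
  have hF₀ : ∀ i ∈ F, i ∉ U₀ := fun i hi => Finset.disjoint_left.1 hFU.2 hi
  have hle : ∀ i ∈ F, lam i ^ d ≤ (2 / a) ^ d * (s / 2 ^ k i) ^ d := by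
    intro i hi
    rw [← mul_pow]
    refine pow_le_pow_left₀ (hpos i).le ?_ d
    rw [div_mul_eq_mul_div, le_div_iff₀ ha]
    exact (hk i (hF₀ i hi)).2
  have h2a : 0 < (2 / a) ^ d := by positivity
  obtain ⟨I, hIF, z, hcov, hI⟩ := exists_dyadic_cover (d := d) hs k (F := F) (by
    refine le_of_mul_le_mul_left ?_ h2a
    rw [← mul_pow, Finset.mul_sum]
    exact hF.trans (Finset.sum_le_sum hle))
  refine ⟨I, fun i => corner (s / 2 ^ k i) (z i) - lam i • p,
    Finset.disjoint_of_subset_left hIF hFU.1, ?_, ?_⟩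
  · refine hcov.trans (Set.iUnion₂_mono fun i hi => ?_)
    calc cell (s / 2 ^ k i) (z i) ⊆ cube (corner (s / 2 ^ k i) (z i)) (lam i * a) :=
          cube_mono _ (hk i (hF₀ i (hIF hi))).1
      _ = (corner (s / 2 ^ k i) (z i) - lam i • p) +ᵥ lam i • cube p a := by
          rw [smul_cube _ _ (hpos i), vadd_cube, sub_add_cancel]
      _ ⊆ _ := Set.vadd_set_mono (Set.smul_set_mono hpK)
  · calc ∑ i ∈ I, lam i ^ d * κ ≤ ∑ i ∈ I, (2 / a) ^ d * (s / 2 ^ k i) ^ d * κ := by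
          gcongr with i hi
          exact hle i (hIF hi)
      _ = (2 / a) ^ d * κ * ∑ i ∈ I, (s / 2 ^ k i) ^ d := by
          rw [Finset.mul_sum]
          exact Finset.sum_congr rfl fun i _ => by ring
      _ ≤ _ := by gcongr

theorem convex_cube (p : Space d) (s : ℝ) : Convex ℝ (cube p s) := by
  intro x hx y hy a b ha hb hab j
  have h1 := hx j
  have h2 := hy j
  simp only [PiLp.add_apply, PiLp.smul_apply, smul_eq_mul]
  have hp : p j = a * p j + b * p j := by rw [← add_mul, hab, one_mul]
  have hs : s = a * s + b * s := by rw [← add_mul, hab, one_mul]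
  constructor
  · nlinarith [mul_le_mul_of_nonneg_left h1.1 ha, mul_le_mul_of_nonneg_left h2.1 hb]
  · rcases ha.eq_or_lt with rfl | ha'
    · have hb1 : b = 1 := by linarith
      subst hb1
      linarith [h2.2]
    · nlinarith [mul_lt_mul_of_pos_left h1.2 ha', mul_le_mul_of_nonneg_left h2.2.le hb]

theorem exists_subset_cube (hb : Bornology.IsBounded K) :
    ∃ (q : Space d) (b : ℝ), 0 < b ∧ K ⊆ cube q b := by
  obtain ⟨R, hR⟩ := hb.subset_closedBall 0
  refine ⟨WithLp.toLp 2 fun _ => -(|R| + 1), 2 * (|R| + 1) + 1, by positivity, ?_⟩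
  intro x hx j
  have h1 := hR hx
  rw [mem_closedBall_zero_iff] at h1
  have h2 := abs_le.1 ((abs_coord_le_norm x j).trans (h1.trans (le_abs_self R)))
  change -(|R| + 1) ≤ x j ∧ x j < -(|R| + 1) + (2 * (|R| + 1) + 1)
  constructor <;> linarith [h2.1, h2.2, abs_nonneg R]

/-- Closing the cube and opening A makes the remainder compact when A sits in a cell, at no cost in
volume, since convex sets have null frontiers. -/
theorem volume_closure_sdiff_interior {p : Space d} {h : ℝ} (hh : 0 ≤ h) {A : Set (Space d)}
    (hA : Convex ℝ A) (hAp : A ⊆ cube p h) (hAtop : volume A ≠ ⊤) :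
    volume (closure (cube p h) \ interior A) =
      ENNReal.ofReal (h ^ d - (volume A).toReal) := by
  have h1 : volume (closure (cube p h)) = ENNReal.ofReal (h ^ d) := by
    rw [measure_closure_of_null_frontier ((convex_cube p h).addHaar_frontier volume),
      volume_cube' _ hh]
  have h2 : volume (interior A) = volume A :=
    measure_interior_of_null_frontier (hA.addHaar_frontier volume)
  rw [measure_sdiff (interior_subset.trans (hAp.trans subset_closure))
    isOpen_interior.measurableSet.nullMeasurableSet (by rw [h2]; exact hAtop), h1, h2,
    ENNReal.ofReal_sub _ ENNReal.toReal_nonneg, ENNReal.ofReal_toReal hAtop]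

end

/-! ### Sequences converging to zero -/

section

variable {d : ℕ} {K : Set (Space d)} {lam : ℕ → ℝ}

/-- Filling a dyadic dissection of the cube with one body in each part, and covering the rest of the
parts at cost `c`, one covers cubes at a cost which is lower than `c` unless `c ≤ 1`. -/
theorem CubesCoverableAtCost.improve (hconv : Convex ℝ K) (hbd : Bornology.IsBounded K)
    (hpos : ∀ i, 0 < lam i) (hlim : Tendsto lam atTop (𝓝 0))
    (hsum : ¬ Summable fun i => lam i ^ d) {q : Space d} {b : ℝ} (hb : 0 < b) (hKq : K ⊆ cube q b)
    {c ε : ℝ} (hc1 : 1 ≤ c) (hε : 0 < ε)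
    (hcoef : 0 ≤ c * (1 + ε) - (c - 1) * ((volume K).toReal / (2 * b) ^ d))
    (h : CubesCoverableAtCost K lam c) :
    CubesCoverableAtCost K lam (c * (1 + ε) - (c - 1) * ((volume K).toReal / (2 * b) ^ d)) := by
  classical
  set κ := (volume K).toReal with hκ
  have hκ0 : 0 ≤ κ := ENNReal.toReal_nonneg
  have hKtop : volume K ≠ ⊤ := hbd.measure_lt_top.ne
  intro s hs U
  obtain ⟨U₀, hU₀⟩ := exists_finset_small hlim (show 0 < s / b by positivity)
  have hk : ∀ i, ∃ n : ℕ, i ∉ U₀ → s / 2 ^ (n + 1) ≤ lam i * b ∧ lam i * b ≤ s / 2 ^ n := by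
    intro i
    by_cases hi : i ∈ U₀
    · exact ⟨0, fun h => absurd hi h⟩
    · obtain ⟨n, h1⟩ := exists_dyadic_near hs (mul_pos (hpos i) hb)
        ((lt_div_iff₀ hb).1 (hU₀ i hi)).le
      exact ⟨n, fun _ => h1⟩
  choose k hk using hk
  obtain ⟨F, hFU, hF⟩ := exists_disjoint_le_sum (fun i => pow_nonneg (hpos i).le d) hsum (U ∪ U₀)
    ((s / b) ^ d)
  rw [Finset.disjoint_union_right] at hFU
  have hF₀ : ∀ i ∈ F, i ∉ U₀ := fun i hi => Finset.disjoint_left.1 hFU.2 hi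
  obtain ⟨I, hIF, z, hcov, hI⟩ := exists_dyadic_cover (d := d) hs k (F := F) (by
    have h1 : ∑ i ∈ F, b ^ d * lam i ^ d ≤ ∑ i ∈ F, (s / 2 ^ k i) ^ d := by
      refine Finset.sum_le_sum fun i hi => ?_
      rw [← mul_pow, mul_comm]
      exact pow_le_pow_left₀ (mul_nonneg (hpos i).le hb.le) (hk i (hF₀ i hi)).2 d
    rw [← Finset.mul_sum] at h1
    refine le_trans ?_ h1
    rw [div_pow, div_le_iff₀ (by positivity)] at hF
    linarith)
  set w : ℕ → ℝ := fun i => s / 2 ^ k i with hw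
  have hw0 : ∀ i, 0 < w i := fun i => by positivity
  set x : ℕ → Space d := fun i => corner (w i) (z i) - lam i • q with hx
  have hbody : ∀ i ∈ I, x i +ᵥ lam i • K ⊆ cell (w i) (z i) := by
    intro i hi
    calc x i +ᵥ lam i • K ⊆ x i +ᵥ lam i • cube q b :=
          Set.vadd_set_mono (Set.smul_set_mono hKq)
      _ = cube (corner (w i) (z i)) (lam i * b) := by
        rw [smul_cube _ _ (hpos i), vadd_cube, hx, sub_add_cancel]
      _ ⊆ _ := cube_mono _ (hk i (hF₀ i (hIF hi))).2
  have hvol : ∀ i, volume (x i +ᵥ lam i • K) = ENNReal.ofReal (lam i ^ d * κ) := fun i =>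
    volume_body_eq_ofReal hKtop _ (hpos i).le
  -- The summand `ε * w i ^ d` gives the strict volume inequality required for covering a compact
  -- set.
  have hrest : ∀ i ∈ I, CoverableAtCost K lam
      (closure (cell (w i) (z i)) \ interior (x i +ᵥ lam i • K))
      (c * (w i ^ d - lam i ^ d * κ + ε * w i ^ d)) := by
    intro i hi
    have hle : lam i ^ d * κ ≤ w i ^ d := by
      have := measure_mono (μ := volume) (hbody i hi)
      rw [hvol, volume_cell (hw0 i)] at this
      exact (ENNReal.ofReal_le_ofReal_iff (pow_nonneg (hw0 i).le d)).1 this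
    refine h.compact (by linarith) ?_ ?_
    · refine IsCompact.diff ?_ isOpen_interior
      exact (Metric.isBounded_closedBall.subset
        (cube_subset_closedBall _ (hw0 i).le)).isCompact_closure
    · rw [cell, volume_closure_sdiff_interior (hw0 i).le ((hconv.smul _).vadd _) (hbody i hi)
        (by rw [hvol]; exact ENNReal.ofReal_ne_top), hvol,
        ENNReal.toReal_ofReal (mul_nonneg (pow_nonneg (hpos i).le d) hκ0)]
      have h2 : 0 < ε * w i ^ d := mul_pos hε (pow_pos (hw0 i) d)
      exact (ENNReal.ofReal_lt_ofReal_iff (by linarith)).2 (by linarith)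
  obtain ⟨I', x', hI'U, hcov', hI'⟩ := CoverableAtCost.biUnion I hrest (U ∪ I)
  rw [Finset.disjoint_union_right] at hI'U
  refine ⟨I ∪ I', fun i => if i ∈ I then x i else x' i,
    Finset.disjoint_union_left.2 ⟨Finset.disjoint_of_subset_left hIF hFU.1, hI'U.1⟩, ?_, ?_⟩
  · refine Set.Subset.trans ?_ (biUnion_piecewise_subset hI'U.2 x x')
    intro y hy
    obtain ⟨i, hi, hyi⟩ := Set.mem_iUnion₂.1 (hcov hy)
    by_cases hyb : y ∈ x i +ᵥ lam i • K
    · exact Or.inl (Set.mem_iUnion₂.2 ⟨i, hi, hyb⟩)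
    · refine Or.inr (hcov' (Set.mem_iUnion₂.2 ⟨i, hi, subset_closure hyi, ?_⟩))
      exact fun hmem => hyb (interior_subset hmem)
  · rw [Finset.sum_union hI'U.2.symm]
    set f := κ / (2 * b) ^ d with hf
    -- Since w i ≤ 2b * lam i, the body fills at least the fraction f of its cell. The filled part
    -- costs 1 per unit instead of c, which saves (c-1)f because c ≥ 1.
    have hterm : ∀ i ∈ I, lam i ^ d * κ + c * (w i ^ d - lam i ^ d * κ + ε * w i ^ d) ≤
        (c * (1 + ε) - (c - 1) * f) * w i ^ d := by
      intro i hi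
      have h1 : f * w i ^ d ≤ lam i ^ d * κ := by
        have h2 : w i ≤ 2 * b * lam i := by
          have := (hk i (hF₀ i (hIF hi))).1
          rw [pow_succ, ← div_div, div_le_iff₀ two_pos] at this
          linarith
        calc f * w i ^ d ≤ f * (2 * b * lam i) ^ d := by
              have := (hw0 i).le
              gcongr
          _ = lam i ^ d * κ := by
            rw [hf, mul_pow (2 * b)]
            have : (2 * b) ^ d ≠ 0 := by positivity
            field_simp
      nlinarith
    calc _ ≤ ∑ i ∈ I, lam i ^ d * κ + ∑ i ∈ I, c * (w i ^ d - lam i ^ d * κ + ε * w i ^ d) := by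
          gcongr
      _ = ∑ i ∈ I, (lam i ^ d * κ + c * (w i ^ d - lam i ^ d * κ + ε * w i ^ d)) := by
          rw [Finset.sum_add_distrib]
      _ ≤ ∑ i ∈ I, (c * (1 + ε) - (c - 1) * f) * w i ^ d := Finset.sum_le_sum hterm
      _ = (c * (1 + ε) - (c - 1) * f) * ∑ i ∈ I, w i ^ d := by rw [Finset.mul_sum]
      _ ≤ _ := by gcongr

theorem CubesCoverableAtCost.mono {c c' : ℝ} (h : CubesCoverableAtCost K lam c) (hcc : c ≤ c') :
    CubesCoverableAtCost K lam c' := fun s hs =>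
  (h s hs).mono subset_rfl (by gcongr)

/-- If the infimum of the admissible costs c ≥ 1 exceeded 1, then `CubesCoverableAtCost.improve`,
applied to a cost near the infimum, would go below it, because the gain (c-1)f is bounded away from
0. -/
theorem cubesCoverableAtCost_of_one_lt (hconv : Convex ℝ K) (hbd : Bornology.IsBounded K)
    (hint : (interior K).Nonempty) (hpos : ∀ i, 0 < lam i) (hlim : Tendsto lam atTop (𝓝 0))
    (hsum : ¬ Summable fun i => lam i ^ d) {c : ℝ} (hc : 1 < c) :
    CubesCoverableAtCost K lam c := by
  obtain ⟨q, b, hb, hKq⟩ := exists_subset_cube hbd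
  set f := (volume K).toReal / (2 * b) ^ d with hf
  have hKtop : volume K ≠ ⊤ := hbd.measure_lt_top.ne
  have hf0 : 0 < f := by
    have : 0 < (volume K).toReal := ENNReal.toReal_pos
      ((isOpen_interior.measure_pos volume hint).trans_le (measure_mono interior_subset)).ne' hKtop
    positivity
  have hf1 : f ≤ 1 := by
    rw [hf, div_le_one (by positivity)]
    have h1 := measure_mono (μ := volume) hKq
    rw [volume_cube' _ hb.le] at h1
    have h2 := ENNReal.toReal_mono ENNReal.ofReal_ne_top h1
    rw [ENNReal.toReal_ofReal (by positivity)] at h2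
    exact h2.trans (pow_le_pow_left₀ hb.le (by linarith) d)
  set A : Set ℝ := {c | 1 ≤ c ∧ CubesCoverableAtCost K lam c} with hA
  have hAne : A.Nonempty := by
    obtain ⟨c₀, hc₀⟩ := exists_cubesCoverableAtCost hint hpos hlim hsum
    exact ⟨max 1 c₀, le_max_left _ _, hc₀.mono (le_max_right _ _)⟩
  have hAbdd : BddBelow A := ⟨1, fun c hc => hc.1⟩
  have hinf : sInf A ≤ 1 := by
    by_contra hgt
    push Not at hgt
    set g := (sInf A - 1) * f with hg
    have hg0 : 0 < g := mul_pos (by linarith) hf0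
    obtain ⟨c', ⟨hc'1, hc'⟩, hc'lt⟩ := exists_lt_of_csInf_lt hAne
      (show sInf A < sInf A + g / 3 by linarith)
    have hc'inf : sInf A ≤ c' := csInf_le hAbdd ⟨hc'1, hc'⟩
    -- The gain is at least g, while the excess of c' over the infimum is below g/3 and the loss c'ε
    -- equals g/3. The new cost is thus below the infimum; it is still at least 1 because f ≤ 1.
    set ε := g / (3 * c') with hε
    have hc'pos : 0 < c' := by linarith
    have hε0 : 0 < ε := by positivity
    have hcε : c' * ε = g / 3 := by rw [hε]; field_simp
    have hge : 1 ≤ c' * (1 + ε) - (c' - 1) * f := by nlinarith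
    have hnew := hc'.improve hconv hbd hpos hlim hsum hb hKq hc'1 hε0 (by linarith)
    have hle : sInf A ≤ c' * (1 + ε) - (c' - 1) * f := csInf_le hAbdd ⟨hge, hnew⟩
    nlinarith
  obtain ⟨c', ⟨-, hc'⟩, hlt⟩ := exists_lt_of_csInf_lt hAne (hinf.trans_lt hc)
  exact hc'.mono hlt.le

/-- The lower bound only says that a covering has at least the volume of the cube. The upper bound
is cost 1 + ε, with no boundary term, so D = 0. -/
theorem hasCubeCoverings_of_tendsto_zero (hconv : Convex ℝ K) (hbd : Bornology.IsBounded K)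
    (hint : (interior K).Nonempty) (hpos : ∀ i, 0 < lam i) (hlim : Tendsto lam atTop (𝓝 0))
    (hsum : ¬ Summable fun i => lam i ^ d) : HasCubeCoverings K lam 1 := by
  classical
  have hKtop : volume K ≠ ⊤ := hbd.measure_lt_top.ne
  refine ⟨0, le_rfl, fun ε hε s hs p U => ?_⟩
  have h1 := (cubesCoverableAtCost_of_one_lt hconv hbd hint hpos hlim hsum
    (show 1 < 1 + ε by linarith) s hs).vadd p
  rw [vadd_cube, add_zero] at h1
  obtain ⟨I, x, hIU, hcov, hcost⟩ := h1 U
  set I' := I.filter (fun i => ((x i +ᵥ lam i • K) ∩ cube p s).Nonempty) with hI'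
  have hcov' : cube p s ⊆ ⋃ i ∈ I', x i +ᵥ lam i • K := by
    intro y hy
    obtain ⟨i, hi, hyi⟩ := Set.mem_iUnion₂.1 (hcov hy)
    exact Set.mem_iUnion₂.2 ⟨i, Finset.mem_filter.2 ⟨hi, y, hyi, hy⟩, hyi⟩
  have hnn : ∀ i, 0 ≤ lam i ^ d * (volume K).toReal := fun i =>
    mul_nonneg (pow_nonneg (hpos i).le d) ENNReal.toReal_nonneg
  refine ⟨I', x, Finset.disjoint_of_subset_left (Finset.filter_subset _ _) hIU, hcov',
    fun i hi => (Finset.mem_filter.1 hi).2, ?_, ?_⟩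
  · have h2 : volume (cube p s) ≤ ∑ i ∈ I', volume (x i +ᵥ lam i • K) :=
      (measure_mono hcov').trans (measure_biUnion_finset_le _ _)
    rw [sum_volume_body hKtop x hpos, volume_cube' _ hs.le,
      ENNReal.ofReal_le_ofReal_iff (Finset.sum_nonneg fun i _ => hnn i)] at h2
    have := pow_pos hs d
    nlinarith
  · rw [add_zero]
    exact (Finset.sum_le_sum_of_subset_of_nonneg (Finset.filter_subset _ _)
      fun i _ _ => hnn i).trans hcost

theorem tendsto_zero_of_mapClusterPt (hpos : ∀ i, 0 < lam i) (hbdd : BddAbove (Set.range lam))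
    (hcl : ∀ c : ℝ, MapClusterPt c atTop lam → c = 0) : Tendsto lam atTop (𝓝 0) := by
  obtain ⟨M, hM⟩ := hbdd
  rw [Metric.tendsto_atTop']
  by_contra hcon
  push Not at hcon
  obtain ⟨ε, hε, hfreq⟩ := hcon
  have h1 : ∃ᶠ i in atTop, lam i ∈ Set.Icc ε M := by
    rw [frequently_atTop']
    intro N
    obtain ⟨n, hn, hn'⟩ := hfreq N
    refine ⟨n, hn, ?_, hM ⟨n, rfl⟩⟩
    rwa [Real.dist_eq, sub_zero, abs_of_pos (hpos n)] at hn'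
  obtain ⟨c, hc, hcc⟩ := isCompact_Icc.exists_mapClusterPt_of_frequently h1
  have := hcl c hcc
  linarith [hc.1]

end

/-! ### Touching balls, and Steinitz' theorem -/

section

variable {d : ℕ}

/-- Balls inside a convex body `K` which touch the supporting hyperplane of `K` with normal `u`
exist, with a common radius, for normals `u` in every open half-space. -/
theorem exists_touching_ball {K : Set (Space d)} (hconv : Convex ℝ K) (hK : IsCompact K)
    (hint : (interior K).Nonempty) : ∃ r : ℝ, 0 < r ∧ ∀ v : Space d, v ≠ 0 → ∃ u q : Space d,
      ‖u‖ = 1 ∧ Metric.closedBall q r ⊆ K ∧ (∀ y ∈ K, inner ℝ y u ≤ inner ℝ q u + r) ∧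
      0 < inner ℝ u v := by
  obtain ⟨q₀, hq₀⟩ := id hint
  obtain ⟨R, hR, hRK⟩ := Metric.isOpen_iff.1 isOpen_interior q₀ hq₀
  set r : ℝ := R / 3 with hr
  have hr0 : 0 < r := by positivity
  have h2r : Metric.closedBall q₀ (2 * r) ⊆ K :=
    (Metric.closedBall_subset_ball (by rw [hr]; linarith)).trans (hRK.trans interior_subset)
  refine ⟨r, hr0, fun v hv => ?_⟩
  have hvn : 0 < ‖v‖ := norm_pos_iff.2 hv
  -- A ball of radius r slides from q₀ in direction v as far as K allows. At the last position it
  -- touches the boundary of K, and a supporting hyperplane there provides u.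
  set S : Set ℝ := {t | 0 ≤ t ∧ Metric.closedBall (q₀ + t • v) r ⊆ K} with hS
  have hS_eq : S = Set.Ici 0 ∩ ⋂ w ∈ Metric.closedBall (0 : Space d) r,
      (fun t : ℝ => q₀ + t • v + w) ⁻¹' K := by
    ext t
    simp only [hS, Set.mem_ofPred_eq, Set.mem_inter_iff, Set.mem_Ici, Set.mem_iInter,
      Set.mem_preimage]
    refine and_congr_right fun _ => ⟨fun h w hw => h ?_, fun h y hy => ?_⟩
    · rw [mem_closedBall_zero_iff] at hw
      rwa [Metric.mem_closedBall, dist_eq_norm, add_sub_cancel_left]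
    · have := h (y - (q₀ + t • v)) (by
        rwa [mem_closedBall_zero_iff, ← dist_eq_norm])
      rwa [add_sub_cancel] at this
  have hSclosed : IsClosed S := by
    rw [hS_eq]
    refine isClosed_Ici.inter (isClosed_biInter fun w _ => hK.isClosed.preimage ?_)
    fun_prop
  have hSbdd : Bornology.IsBounded S := by
    obtain ⟨M, hM⟩ := hK.isBounded.subset_closedBall q₀
    refine (Metric.isBounded_closedBall (x := (0 : ℝ)) (r := M / ‖v‖)).subset ?_
    rintro t ⟨ht0, ht⟩
    have h1 := hM (ht (Metric.mem_closedBall_self hr0.le))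
    rw [Metric.mem_closedBall, dist_eq_norm, add_sub_cancel_left, norm_smul] at h1
    rw [mem_closedBall_zero_iff, le_div_iff₀ hvn]
    exact h1
  have hScompact : IsCompact S := Metric.isCompact_of_isClosed_isBounded hSclosed hSbdd
  have hSne : S.Nonempty := ⟨0, le_rfl, by
    rw [zero_smul, add_zero]
    exact (Metric.closedBall_subset_closedBall (by linarith)).trans h2r⟩
  obtain ⟨t, ⟨ht0, htK⟩, htmax⟩ := hScompact.exists_isGreatest hSne
  set q := q₀ + t • v with hq
  have hnot : ¬ Metric.closedBall q r ⊆ interior K := by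
    intro hsub
    obtain ⟨δ, hδ, hδK⟩ := (isCompact_closedBall q r).exists_thickening_subset_open
      isOpen_interior hsub
    have hmem : t + δ / (2 * ‖v‖) ∈ S := by
      refine ⟨by positivity, fun y hy => interior_subset (hδK ?_)⟩
      rw [Metric.mem_thickening_iff]
      refine ⟨y - (δ / (2 * ‖v‖)) • v, ?_, ?_⟩
      · rw [Metric.mem_closedBall, dist_eq_norm] at hy ⊢
        convert hy using 2
        rw [hq, add_smul]
        abel
      · rw [dist_eq_norm, sub_sub_cancel, norm_smul, Real.norm_of_nonneg (by positivity)]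
        have : δ / (2 * ‖v‖) * ‖v‖ = δ / 2 := by field_simp
        rw [this]
        linarith
    have := htmax hmem
    have h3 : 0 < δ / (2 * ‖v‖) := by positivity
    linarith
  obtain ⟨p, hpq, hp⟩ := Set.not_subset.1 hnot
  obtain ⟨f, hf⟩ := geometric_hahn_banach_open_point hconv.interior isOpen_interior hp
  have hfK : ∀ y ∈ K, f y ≤ f p := by
    intro y hy
    have hy' : y ∈ closure (interior K) := by
      rw [hconv.closure_interior_eq_closure_of_nonempty_interior hint]
      exact subset_closure hy
    have hcl : IsClosed {y | f y ≤ f p} := isClosed_le f.continuous continuous_const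
    exact closure_minimal (fun z hz => (hf z hz).le) hcl hy'
  set u₀ := (InnerProductSpace.toDual ℝ (Space d)).symm f with hu₀
  have hfu : ∀ y, f y = inner ℝ y u₀ := by
    intro y
    rw [real_inner_comm, hu₀, InnerProductSpace.toDual_symm_apply]
  have hu₀ne : u₀ ≠ 0 := by
    intro h0
    have := hf q₀ hq₀
    rw [hfu, hfu, h0, inner_zero_right, inner_zero_right] at this
    exact lt_irrefl _ this
  have hun : 0 < ‖u₀‖ := norm_pos_iff.2 hu₀ne
  set u := ‖u₀‖⁻¹ • u₀ with hu
  have hu1 : ‖u‖ = 1 := by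
    rw [hu, norm_smul, norm_inv, norm_norm, inv_mul_cancel₀ hun.ne']
  have hKp : ∀ y ∈ K, inner ℝ y u ≤ inner ℝ p u := by
    intro y hy
    rw [hu, inner_smul_right, inner_smul_right, ← hfu, ← hfu]
    exact mul_le_mul_of_nonneg_left (hfK y hy) (inv_nonneg.2 hun.le)
  have hpu : inner ℝ p u ≤ inner ℝ q u + r := by
    have h1 : inner ℝ (p - q) u ≤ ‖p - q‖ * ‖u‖ := real_inner_le_norm _ _
    rw [inner_sub_left, hu1, mul_one] at h1
    rw [Metric.mem_closedBall, dist_eq_norm] at hpq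
    linarith
  have htouch : ∀ y ∈ K, inner ℝ y u ≤ inner ℝ q u + r := fun y hy => (hKp y hy).trans hpu
  refine ⟨u, q, hu1, htK, htouch, ?_⟩
  clear_value u
  -- The spare room at the start decides the sign: the point q₀ + 2ru of K gives ⟨q₀,u⟩ + 2r ≤ ⟨q,u⟩
  -- + r, so ⟨tv,u⟩ ≥ r > 0.
  have h1 := htouch (q₀ + (2 * r) • u) (h2r (by
    rw [Metric.mem_closedBall, dist_eq_norm, add_sub_cancel_left, norm_smul, hu1, mul_one,
      Real.norm_of_nonneg (by positivity)]))
  rw [hq, inner_add_left, inner_add_left, inner_smul_left, inner_smul_left,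
    real_inner_self_eq_norm_sq, hu1] at h1
  simp only [conj_trivial] at h1
  have h2 : 0 < t * inner ℝ v u := by linarith
  rw [real_inner_comm]
  exact pos_of_mul_pos_right h2 ht0

/-- Carathéodory's theorem for cones: a conic combination of finitely many vectors is a conic
combination of linearly independent ones among them. -/
theorem exists_conic_linearIndependent {E : Type*} [AddCommGroup E] [Module ℝ E] (n : ℕ) :
    ∀ (F : Finset E) (c : E → ℝ), F.card = n → (∀ u ∈ F, 0 ≤ c u) →
      ∃ F' ⊆ F, ∃ c' : E → ℝ, (∀ u ∈ F', 0 ≤ c' u) ∧ ∑ u ∈ F', c' u • u = ∑ u ∈ F, c u • u ∧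
        LinearIndependent ℝ (fun u : F' => (u : E)) := by
  classical
  induction n with
  | zero =>
    intro F c hF hc
    rw [Finset.card_eq_zero] at hF
    subst hF
    exact ⟨∅, subset_rfl, c, by simp, by simp, linearIndependent_empty_type⟩
  | succ n ih =>
    intro F c hF hc
    by_cases hli : LinearIndependent ℝ (fun u : F => (u : E))
    · exact ⟨F, subset_rfl, c, hc, rfl, hli⟩
    · obtain ⟨g₀, hg₀, i₀, hi₀⟩ := Fintype.not_linearIndependent_iff.1 hli
      obtain ⟨g, hg, u₁, hu₁F, hu₁⟩ : ∃ g : E → ℝ, ∑ u ∈ F, g u • u = 0 ∧ ∃ u ∈ F, 0 < g u := by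
        have hext : ∀ σ : ℝ, ∑ u ∈ F, (if h : u ∈ F then σ * g₀ ⟨u, h⟩ else 0) • u = 0 := by
          intro σ
          rw [← Finset.sum_coe_sort]
          have : ∀ u : F, (if h : (u : E) ∈ F then σ * g₀ ⟨u, h⟩ else 0) • (u : E) =
              σ • (g₀ u • (u : E)) := by
            intro u
            rw [dif_pos u.2, smul_smul]
          rw [Finset.sum_congr rfl fun u _ => this u, ← Finset.smul_sum, hg₀, smul_zero]
        rcases lt_or_gt_of_ne hi₀ with h | h
        · refine ⟨_, hext (-1), i₀, i₀.2, ?_⟩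
          rw [dif_pos i₀.2]
          simp only [Subtype.coe_eta]
          linarith
        · refine ⟨_, hext 1, i₀, i₀.2, ?_⟩
          rw [dif_pos i₀.2]
          simp only [Subtype.coe_eta]
          linarith
      -- Subtracting the relation g with the smallest ratio c/g kills the coefficient of `u₀` and
      -- keeps the others nonnegative.
      obtain ⟨u₀, hu₀, hmin⟩ := (F.filter fun u => 0 < g u).exists_min_image (fun u => c u / g u)
        ⟨u₁, Finset.mem_filter.2 ⟨hu₁F, hu₁⟩⟩
      obtain ⟨hu₀F, hgu₀⟩ := Finset.mem_filter.1 hu₀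
      set t := c u₀ / g u₀ with ht
      have ht0 : 0 ≤ t := div_nonneg (hc u₀ hu₀F) hgu₀.le
      have hc' : ∀ u ∈ F, 0 ≤ c u - t * g u := by
        intro u hu
        rcases le_or_gt (g u) 0 with h | h
        · nlinarith [hc u hu]
        · have := hmin u (Finset.mem_filter.2 ⟨hu, h⟩)
          rw [le_div_iff₀ h] at this
          linarith
      have hsum : ∑ u ∈ F.erase u₀, (c u - t * g u) • u = ∑ u ∈ F, c u • u := by
        have h0 : c u₀ - t * g u₀ = 0 := by
          rw [ht, div_mul_cancel₀ _ hgu₀.ne', sub_self]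
        have h1 := Finset.add_sum_erase F (fun u => (c u - t * g u) • u) hu₀F
        simp only [h0, zero_smul, zero_add] at h1
        rw [h1]
        simp only [sub_smul, Finset.sum_sub_distrib, mul_smul]
        rw [← Finset.smul_sum, hg, smul_zero, sub_zero]
      obtain ⟨F', hF', c', h1, h2, h3⟩ := ih (F.erase u₀) (fun u => c u - t * g u)
        (by rw [Finset.card_erase_of_mem hu₀F, hF]; rfl)
        (fun u hu => hc' u (Finset.mem_of_mem_erase hu))
      exact ⟨F', hF'.trans (Finset.erase_subset _ _), c', h1, h2.trans hsum, h3⟩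

/-- A set meeting all open half-spaces through the origin has a finite subset which does so
uniformly. -/
theorem exists_finset_uniform {N : Set (Space d)}
    (hN : ∀ v : Space d, v ≠ 0 → ∃ u ∈ N, 0 < inner ℝ u v) :
    ∃ F : Finset (Space d), ↑F ⊆ N ∧ ∃ m : ℝ, 0 < m ∧
      ∀ v : Space d, v ≠ 0 → ∃ u ∈ F, m * ‖v‖ ≤ inner ℝ u v := by
  classical
  have hcov : Metric.sphere (0 : Space d) 1 ⊆
      ⋃ q : N × ℕ, {v | 1 / ((q.2 : ℝ) + 1) < inner ℝ (q.1 : Space d) v} := by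
    intro v hv
    rw [mem_sphere_zero_iff_norm] at hv
    obtain ⟨u, hu, huv⟩ := hN v (by
      intro h0
      rw [h0, norm_zero] at hv
      exact zero_ne_one hv)
    obtain ⟨n, hn⟩ := exists_nat_one_div_lt huv
    exact Set.mem_iUnion.2 ⟨(⟨u, hu⟩, n), hn⟩
  obtain ⟨T, hT⟩ := (isCompact_sphere (0 : Space d) 1).elim_finite_subcover _ (fun q => by
    exact isOpen_lt continuous_const (continuous_const.inner continuous_id)) hcov
  refine ⟨T.image fun q => (q.1 : Space d), ?_, 1 / ((T.sup fun q => q.2 : ℕ) + 1 : ℝ),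
    by positivity, ?_⟩
  · intro u hu
    rw [Finset.mem_coe, Finset.mem_image] at hu
    obtain ⟨q, -, rfl⟩ := hu
    exact q.1.2
  · intro v hv
    have hvn : 0 < ‖v‖ := norm_pos_iff.2 hv
    have hsph : ‖v‖⁻¹ • v ∈ Metric.sphere (0 : Space d) 1 := by
      rw [mem_sphere_zero_iff_norm, norm_smul, norm_inv, norm_norm, inv_mul_cancel₀ hvn.ne']
    obtain ⟨q, hq, hqv⟩ := Set.mem_iUnion₂.1 (hT hsph)
    refine ⟨q.1, Finset.mem_image_of_mem _ hq, ?_⟩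
    rw [Set.mem_ofPred_eq, inner_smul_right, inv_mul_eq_div, lt_div_iff₀ hvn] at hqv
    refine le_trans ?_ hqv.le
    have hle : q.2 ≤ T.sup fun q => q.2 := Finset.le_sup (f := fun q => q.2) hq
    have hle' : (q.2 : ℝ) ≤ (T.sup fun q => q.2 : ℕ) := by exact_mod_cast hle
    gcongr

/-- Steinitz' theorem: a set meeting all open half-spaces through the origin contains at most `2d`
points with the same property. -/
theorem exists_finset_card_le_two_mul {N : Set (Space d)}
    (hN : ∀ v : Space d, v ≠ 0 → ∃ u ∈ N, 0 < inner ℝ u v) :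
    ∃ F : Finset (Space d), ↑F ⊆ N ∧ F.card ≤ 2 * d ∧
      ∀ v : Space d, v ≠ 0 → ∃ u ∈ F, 0 < inner ℝ u v := by
  classical
  obtain ⟨F₀, hF₀N, m, hm, hF₀⟩ := exists_finset_uniform hN
  have hspan : Submodule.span ℝ N = ⊤ := by
    rw [← Submodule.orthogonal_eq_bot_iff, Submodule.eq_bot_iff]
    intro v hv
    by_contra hv0
    obtain ⟨u, hu, huv⟩ := hN v hv0
    have := (Submodule.mem_orthogonal _ _).1 hv u (Submodule.subset_span hu)
    linarith
  obtain ⟨B₀, hB₀N, hB₀span, hB₀li⟩ := exists_linearIndependent ℝ N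
  have hB₀fin : B₀.Finite := hB₀li.setFinite
  set B := hB₀fin.toFinset with hB
  have hBB₀ : (B : Set (Space d)) = B₀ := hB₀fin.coe_toFinset
  have hBcard : B.card ≤ d := by
    have hli : LinearIndependent ℝ (fun u : B => (u : Space d)) := by
      have := hB₀li
      rw [← hBB₀] at this
      exact this
    simpa using hli.fintype_card_le_finrank
  -- B is a basis taken from N, and w will be a conic combination of at most d further points of N.
  -- A vector v with no positive inner product against these points has ⟨w,v⟩ ≤ 0 and all ⟨b,v⟩ ≤ 0;
  -- as the sum of the latter is -⟨w,v⟩, all of them vanish and v = 0.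
  set w : Space d := -∑ b ∈ B, b with hw
  obtain ⟨c, hc0, hcw⟩ : ∃ c : Space d → ℝ, (∀ u ∈ F₀, 0 ≤ c u) ∧ ∑ u ∈ F₀, c u • u = w := by
    by_cases hw0 : w = 0
    · exact ⟨fun _ => 0, fun _ _ => le_rfl, by simp [hw0]⟩
    have hwn : 0 < ‖w‖ := norm_pos_iff.2 hw0
    -- With ‖εw‖ = m/2, a hyperplane separating εw from the hull of `F₀` would contradict the
    -- uniform bound m‖v‖.
    set ε := m / (2 * ‖w‖) with hε
    have hε0 : 0 < ε := by positivity
    have hmem : ε • w ∈ convexHull ℝ (F₀ : Set (Space d)) := by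
      by_contra hnot
      obtain ⟨f, s, hfs, hsf⟩ := geometric_hahn_banach_closed_point (convex_convexHull ℝ _)
        (F₀.finite_toSet.isClosed_convexHull ℝ) hnot
      set v := (InnerProductSpace.toDual ℝ (Space d)).symm f with hv
      have hfv : ∀ y, f y = inner ℝ y v := by
        intro y
        rw [real_inner_comm, hv, InnerProductSpace.toDual_symm_apply]
      by_cases hv0 : v = 0
      · obtain ⟨u, hu, -⟩ := hF₀ w hw0
        have h1 := hfs u (subset_convexHull ℝ _ hu)
        rw [hfv, hv0, inner_zero_right] at h1 hsf
        linarith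
      · obtain ⟨u, hu, huv⟩ := hF₀ v hv0
        have h1 := (hfs u (subset_convexHull ℝ _ hu)).trans hsf
        rw [hfv, hfv, inner_smul_left, conj_trivial] at h1
        have h2 : inner ℝ w v ≤ ‖w‖ * ‖v‖ := real_inner_le_norm _ _
        have h3 : ε * inner ℝ w v ≤ ε * (‖w‖ * ‖v‖) := mul_le_mul_of_nonneg_left h2 hε0.le
        have h4 : ε * (‖w‖ * ‖v‖) = m * ‖v‖ / 2 := by
          rw [hε]
          field_simp
        have h5 : 0 < m * ‖v‖ := mul_pos hm (norm_pos_iff.2 hv0)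
        linarith
    obtain ⟨c, hc0, -, hcw⟩ := Finset.mem_convexHull'.1 hmem
    refine ⟨fun u => ε⁻¹ * c u, fun u hu => mul_nonneg (inv_nonneg.2 hε0.le) (hc0 u hu), ?_⟩
    simp only [mul_smul]
    rw [← Finset.smul_sum, hcw, inv_smul_smul₀ hε0.ne']
  obtain ⟨F', hF'F₀, c', hc'0, hc'w, hli⟩ := exists_conic_linearIndependent _ F₀ c rfl hc0
  have hF'card : F'.card ≤ d := by
    simpa using hli.fintype_card_le_finrank
  refine ⟨B ∪ F', ?_, ?_, ?_⟩
  · rw [Finset.coe_union, Set.union_subset_iff, hBB₀]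
    exact ⟨hB₀N, (Finset.coe_subset.2 hF'F₀).trans hF₀N⟩
  · exact (Finset.card_union_le _ _).trans (by omega)
  · intro v hv
    by_contra hcon
    push Not at hcon
    have h1 : inner ℝ w v ≤ 0 := by
      rw [← hcw, ← hc'w, sum_inner]
      refine Finset.sum_nonpos fun u hu => ?_
      rw [inner_smul_left, conj_trivial]
      exact mul_nonpos_of_nonneg_of_nonpos (hc'0 u hu) (hcon u (Finset.mem_union_right _ hu))
    have h2 : ∀ b ∈ B, inner ℝ b v ≤ 0 := fun b hb => hcon b (Finset.mem_union_left _ hb)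
    rw [hw, inner_neg_left, sum_inner] at h1
    have h3 : ∑ b ∈ B, inner ℝ b v = 0 := le_antisymm (Finset.sum_nonpos h2) (by linarith)
    have h4 := (Finset.sum_eq_zero_iff_of_nonpos h2).1 h3
    have h5 : v ∈ (Submodule.span ℝ B₀)ᗮ := by
      rw [Submodule.mem_orthogonal]
      intro y hy
      induction hy using Submodule.span_induction with
      | mem x hx => exact h4 x (by rw [← hBB₀] at hx; exact hx)
      | zero => exact inner_zero_left _
      | add x y _ _ hx hy => rw [inner_add_left, hx, hy, add_zero]
      | smul t x _ hx => rw [inner_smul_left, hx, mul_zero]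
    rw [hB₀span, hspan, Submodule.top_orthogonal_eq_bot, Submodule.mem_bot] at h5
    exact hv h5

end

/-! ### Covering annuli by large homothets -/

section

variable {d : ℕ}

/-- At most `2d` sufficiently large homothets of a convex body can be arranged to cover an annulus
around a given ball without meeting the ball. -/
theorem exists_annulus_covering (hd : 1 ≤ d) {K : Set (Space d)} (hconv : Convex ℝ K)
    (hK : IsCompact K) (hint : (interior K).Nonempty) :
    ∃ F : Finset (Space d), F.card ≤ 2 * d ∧ ∃ C : ℝ, 0 < C ∧ ∀ a b : ℝ, ∃ Λ : ℝ,
      ∀ l : F → ℝ, (∀ u, Λ ≤ l u) → ∃ y : F → Space d,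
        (∀ u, Disjoint (y u +ᵥ l u • K) (Metric.closedBall 0 a)) ∧
        Metric.closedBall 0 b ⊆ Metric.closedBall 0 (C * (a + 2)) ∪ ⋃ u, y u +ᵥ l u • K := by
  classical
  obtain ⟨r, hr, htouch⟩ := exists_touching_ball hconv hK hint
  set N : Set (Space d) := {u | ‖u‖ = 1 ∧ ∃ q, Metric.closedBall q r ⊆ K ∧
    ∀ y ∈ K, inner ℝ y u ≤ inner ℝ q u + r} with hN
  obtain ⟨F₁, hF₁N, hF₁card, hF₁⟩ := exists_finset_card_le_two_mul (N := N) (fun v hv => by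
    obtain ⟨u, q, h1, h2, h3, h4⟩ := htouch v hv
    exact ⟨u, ⟨h1, q, h2, h3⟩, h4⟩)
  obtain ⟨F, hFF₁, m, hm, hF⟩ := exists_finset_uniform (N := (F₁ : Set (Space d))) hF₁
  have hFN : ∀ u : F, (u : Space d) ∈ N := fun u => hF₁N (hFF₁ u.2)
  choose hu1 q hqK htop using hFN
  have hFne : Nonempty F := by
    obtain ⟨u, hu, -⟩ := hF (EuclideanSpace.single ⟨0, hd⟩ 1) (by
      intro h0
      have := congrArg norm h0
      simp at this)
    exact ⟨⟨u, hu⟩⟩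
  refine ⟨F, (Finset.card_le_card hFF₁).trans hF₁card, 1 / m, by positivity, fun a b => ?_⟩
  have hballs : ∀ (u : F) (l : ℝ), 0 < l → ∀ x v : Space d, ‖x - v - l • q u‖ ≤ l * r →
      x ∈ v +ᵥ l • K := by
    intro u l hl x v hx
    refine ⟨x - v, ⟨l⁻¹ • (x - v), hqK u ?_, ?_⟩, ?_⟩
    · have h1 : l⁻¹ • (x - v) - q u = l⁻¹ • (x - v - l • q u) := by
        rw [smul_sub l⁻¹ (x - v), inv_smul_smul₀ hl.ne']
      rw [Metric.mem_closedBall, dist_eq_norm, h1, norm_smul, norm_inv, Real.norm_of_nonneg hl.le,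
        inv_mul_le_iff₀ hl]
      exact hx
    · simp only [smul_inv_smul₀ hl.ne']
    · simp
  -- For a < 0 there is nothing to avoid, and a single body containing the ball of radius b
  -- suffices. This case starts the later construction.
  rcases lt_or_ge a 0 with ha | ha
  · refine ⟨max 1 (b / r), fun l hl => ⟨fun u => -(l u • q u), fun u => ?_, ?_⟩⟩
    · rw [Metric.closedBall_eq_empty.2 ha]
      exact Set.disjoint_empty _
    · intro x hx
      obtain ⟨u⟩ := hFne
      refine Or.inr (Set.mem_iUnion.2 ⟨u, hballs u (l u) ?_ x _ ?_⟩)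
      · exact zero_lt_one.trans_le ((le_max_left _ _).trans (hl u))
      · have h2 := (le_max_right _ _).trans (hl u)
        rw [div_le_iff₀ hr] at h2
        rw [mem_closedBall_zero_iff] at hx
        rw [sub_neg_eq_add, add_sub_cancel_right]
        linarith
  -- Body u is placed in the half-space ⟨x,u⟩ ≤ -(a+1) and contains a ball of radius lr touching its
  -- boundary at -(a+1)u. A point x left to cover has ⟨x,u⟩ < -(a+2) for some u, so e = x + (a+1)u
  -- satisfies ⟨e,u⟩ < -1 and ‖e‖ ≤ β. Hence ‖e + lru‖² ≤ β² - 2lr + (lr)², which is at most (lr)²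
  -- once β² ≤ 2lr.
  · set β : ℝ := |b| + a + 1 with hβ
    refine ⟨max 1 (β ^ 2 / (2 * r)), fun l hl =>
      ⟨fun u => -((a + 1) • (u : Space d)) - l u • (q u + r • (u : Space d)), fun u => ?_, ?_⟩⟩
    · have hl0 : 0 < l u := zero_lt_one.trans_le ((le_max_left _ _).trans (hl u))
      rw [Set.disjoint_left]
      rintro _ ⟨_, ⟨k, hk, rfl⟩, rfl⟩ hball
      rw [mem_closedBall_zero_iff] at hball
      simp only [vadd_eq_add] at hball
      have huu : inner ℝ (u : Space d) (u : Space d) = 1 := by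
        rw [real_inner_self_eq_norm_sq, hu1, one_pow]
      have h1 := abs_le.1 ((abs_real_inner_le_norm (-((a + 1) • (u : Space d)) -
        l u • (q u + r • (u : Space d)) + l u • k) (u : Space d)))
      rw [hu1, mul_one, inner_add_left, inner_sub_left, inner_neg_left, inner_smul_left,
        inner_smul_left, inner_smul_left, inner_add_left, inner_smul_left, huu] at h1
      simp only [conj_trivial, mul_one] at h1
      have h2 := mul_le_mul_of_nonneg_left (htop u k hk) hl0.le
      linarith [h1.1]
    · intro x hx
      rw [mem_closedBall_zero_iff] at hx
      by_cases hxC : ‖x‖ ≤ 1 / m * (a + 2)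
      · exact Or.inl (mem_closedBall_zero_iff.2 hxC)
      · right
        push Not at hxC
        have hxne : x ≠ 0 := by
          rintro rfl
          rw [norm_zero] at hxC
          have : 0 ≤ 1 / m * (a + 2) := by positivity
          linarith
        obtain ⟨u, hu, hux⟩ := hF (-x) (neg_ne_zero.2 hxne)
        rw [norm_neg, inner_neg_right] at hux
        have hxm : a + 2 < m * ‖x‖ := by
          rw [one_div, inv_mul_lt_iff₀ hm] at hxC
          exact hxC
        have hxu : inner ℝ x u < -(a + 2) := by
          rw [real_inner_comm]
          linarith
        have hlu := hl ⟨u, hu⟩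
        have hl0 : 0 < l ⟨u, hu⟩ := zero_lt_one.trans_le ((le_max_left _ _).trans hlu)
        refine Set.mem_iUnion.2 ⟨⟨u, hu⟩, hballs ⟨u, hu⟩ _ hl0 _ _ ?_⟩
        set L := l ⟨u, hu⟩ with hL
        have hn1 : ‖u‖ = 1 := hu1 ⟨u, hu⟩
        have huu : inner ℝ u u = 1 := by rw [real_inner_self_eq_norm_sq, hn1, one_pow]
        set e := x + (a + 1) • u with he
        have heq : x - (-((a + 1) • u) - L • (q ⟨u, hu⟩ + r • u)) - L • q ⟨u, hu⟩ =
            e + (L * r) • u := by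
          rw [he, smul_add, smul_smul]
          abel
        have heu : inner ℝ e u < -1 := by
          rw [he, inner_add_left, inner_smul_left, huu, conj_trivial]
          linarith
        have hen : ‖e‖ ≤ β := by
          refine (norm_add_le _ _).trans ?_
          rw [norm_smul, hn1, mul_one, Real.norm_of_nonneg (by linarith), hβ]
          linarith [le_abs_self b]
        have hβL : β ^ 2 ≤ 2 * (L * r) := by
          have := (le_max_right _ _).trans hlu
          rw [div_le_iff₀ (by positivity)] at this
          linarith
        rw [heq]
        have hLr : 0 < L * r := mul_pos hl0 hr
        refine le_of_sq_le_sq ?_ hLr.le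
        rw [norm_add_sq_real, inner_smul_right, norm_smul, hn1, mul_one,
          Real.norm_of_nonneg hLr.le]
        have h5 : ‖e‖ ^ 2 ≤ β ^ 2 := pow_le_pow_left₀ (norm_nonneg _) hen 2
        nlinarith

end

/-! ### Unbounded sequences -/

section

variable {d : ℕ}

theorem vadd_smul_subset_closedBall_zero {K : Set (Space d)} {D : ℝ}
    (hKD : K ⊆ Metric.closedBall 0 D) (v : Space d) {r : ℝ} (hr : 0 ≤ r) :
    v +ᵥ r • K ⊆ Metric.closedBall 0 (‖v‖ + r * D) := by
  rintro _ ⟨_, ⟨k, hk, rfl⟩, rfl⟩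
  have h1 := hKD hk
  rw [mem_closedBall_zero_iff] at h1 ⊢
  simp only [vadd_eq_add]
  refine (norm_add_le _ _).trans ?_
  rw [norm_smul, Real.norm_of_nonneg hr]
  gcongr

theorem exists_disjoint_closedBall (hd : 1 ≤ d) {K : Set (Space d)} {D : ℝ}
    (hKD : K ⊆ Metric.closedBall 0 D) {r : ℝ} (hr : 0 ≤ r) (R : ℝ) :
    ∃ v : Space d, Disjoint (v +ᵥ r • K) (Metric.closedBall 0 R) := by
  refine ⟨EuclideanSpace.single ⟨0, hd⟩ (|R| + r * |D| + 1), ?_⟩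
  rw [Set.disjoint_left]
  rintro _ ⟨_, ⟨k, hk, rfl⟩, rfl⟩ hball
  have h1 := hKD hk
  rw [mem_closedBall_zero_iff] at h1 hball
  simp only [vadd_eq_add] at hball
  set v : Space d := EuclideanSpace.single ⟨0, hd⟩ (|R| + r * |D| + 1) with hv
  have hvn : ‖v‖ = |R| + r * |D| + 1 := by
    rw [hv, EuclideanSpace.single, PiLp.norm_single, Real.norm_of_nonneg (by positivity)]
  have h2 : ‖v‖ ≤ ‖v + r • k‖ + ‖r • k‖ := by
    have := norm_sub_le (v + r • k) (r • k)
    rwa [add_sub_cancel_right] at this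
  rw [norm_smul, Real.norm_of_nonneg hr, hvn] at h2
  have h3 : r * ‖k‖ ≤ r * |D| := mul_le_mul_of_nonneg_left (h1.trans (le_abs_self D)) hr
  linarith [le_abs_self R]

/-- A stage consists of at most 2d huge bodies S covering the next annulus and at most one leftover
body L, which serves only to use up every index. Each S avoids all bodies of stages at least two
earlier; L avoids all earlier stages and its own S. -/
theorem permitsCoveringOfMultiplicity_of_unbounded (hd : 1 ≤ d) {K : Set (Space d)}
    (hconv : Convex ℝ K) (hK : IsCompact K) (hint : (interior K).Nonempty) {lam : ℕ → ℝ}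
    (hpos : ∀ i, 0 < lam i) (hunb : ¬ BddAbove (Set.range lam)) :
    PermitsCoveringOfMultiplicity (fun i => lam i • K) (4 * d) := by
  classical
  obtain ⟨D, hKD⟩ := hK.isBounded.subset_closedBall 0
  obtain ⟨F, hFcard, C, hC, hann⟩ := exists_annulus_covering hd hconv hK hint
  let B : (ℕ → Space d) → ℕ → Set (Space d) := fun x i => x i +ᵥ lam i • K
  have hBcongr : ∀ {x x' : ℕ → Space d} {i}, x i = x' i → B x i = B x' i := by
    intro x x' i h
    simp only [B, h]
  -- The state holds two radii: all bodies lie in the ball of radius `s.2`, and those placed before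
  -- the previous stage lie in the ball of radius `s.1`.
  let G : ℕ → ℝ × ℝ → ℝ × ℝ → Finset ℕ → (ℕ → Space d) → Prop := fun _ s s' I x =>
    s'.1 = s.2 ∧ s.2 + 1 ≤ s'.2 ∧ (∀ i ∈ I, B x i ⊆ Metric.closedBall 0 s'.2) ∧
    ∃ S L : Finset ℕ, I = S ∪ L ∧ S.card ≤ 2 * d ∧ L.card ≤ 1 ∧
      (∀ i ∈ S, Disjoint (B x i) (Metric.closedBall 0 s.1)) ∧
      Metric.closedBall 0 (C * (s.2 + 2)) ⊆
        Metric.closedBall 0 (C * (s.1 + 2)) ∪ ⋃ i ∈ S, B x i ∧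
      (∀ i ∈ L, Disjoint (B x i) (Metric.closedBall 0 s.2)) ∧
      ∀ i ∈ L, ∀ j ∈ S, Disjoint (B x i) (B x j)
  have hcongr : ∀ k s s' I x x', (∀ i ∈ I, x i = x' i) → G k s s' I x → G k s s' I x' := by
    rintro - s s' I x x' hxx ⟨h1, h2, h3, S, L, rfl, hS, hL, h4, h5, h6, h7⟩
    have hSB : ∀ i ∈ S, B x' i = B x i := fun i hi =>
      hBcongr (hxx i (Finset.mem_union_left _ hi)).symm
    have hLB : ∀ i ∈ L, B x' i = B x i := fun i hi =>
      hBcongr (hxx i (Finset.mem_union_right _ hi)).symm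
    refine ⟨h1, h2, fun i hi => ?_, S, L, rfl, hS, hL, fun i hi => ?_, ?_, fun i hi => ?_,
      fun i hi j hj => ?_⟩
    · rw [hBcongr (hxx i hi).symm]
      exact h3 i hi
    · rw [hSB i hi]
      exact h4 i hi
    · rw [Set.iUnion₂_congr hSB]
      exact h5
    · rw [hLB i hi]
      exact h6 i hi
    · rw [hLB i hi, hSB j hj]
      exact h7 i hi j hj
  have hstep : ∀ k U (s : ℝ × ℝ), ∃ I x s', Disjoint I U ∧ (k ∈ U ∨ k ∈ I) ∧ G k s s' I x := by
    rintro k U ⟨a, b⟩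
    obtain ⟨Λ, hΛ⟩ := hann a (C * (b + 2))
    have hinf : {i | Λ ≤ lam i}.Infinite := by
      intro hfin
      obtain ⟨M, hM⟩ := (hfin.image lam).bddAbove
      refine hunb ⟨max Λ M, ?_⟩
      rintro _ ⟨i, rfl⟩
      rcases le_or_gt Λ (lam i) with h | h
      · exact (hM ⟨i, h, rfl⟩).trans (le_max_right _ _)
      · exact h.le.trans (le_max_left _ _)
    obtain ⟨S, hSsub, hScard⟩ := (hinf.sdiff U.finite_toSet).exists_subset_card_eq F.card
    have hSU : Disjoint S U := Finset.disjoint_left.2 fun i hi => (hSsub hi).2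
    let g := Finset.equivOfCardEq hScard
    obtain ⟨y, hy1, hy2⟩ := hΛ (fun u => lam (g.symm u)) (fun u => (hSsub (g.symm u).2).1)
    let x : ℕ → Space d := fun i => if h : i ∈ S then y (g ⟨i, h⟩) else 0
    have hxS : ∀ u : F, B x (g.symm u) = y u +ᵥ lam (g.symm u) • K := by
      intro u
      simp only [B, x]
      rw [dif_pos (g.symm u).2]
      simp only [Subtype.coe_eta, Equiv.apply_symm_apply]
    have hSdisj : ∀ i ∈ S, Disjoint (B x i) (Metric.closedBall 0 a) := by
      intro i hi
      have h1 := hy1 (g ⟨i, hi⟩)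
      rw [← hxS] at h1
      simpa using h1
    have hScov : Metric.closedBall 0 (C * (b + 2)) ⊆
        Metric.closedBall 0 (C * (a + 2)) ∪ ⋃ i ∈ S, B x i := by
      refine hy2.trans (Set.union_subset_union_right _ (Set.iUnion_subset fun u => ?_))
      rw [← hxS]
      exact Set.subset_biUnion_of_mem (u := B x) (g.symm u).2
    have hbd : ∀ (T : Finset ℕ) (x : ℕ → Space d), ∃ R, b + 1 ≤ R ∧
        ∀ i ∈ T, B x i ⊆ Metric.closedBall 0 R := by
      intro T x
      have hT : Bornology.IsBounded (⋃ i ∈ T, B x i) := by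
        rw [Bornology.isBounded_biUnion_finset]
        intro i _
        exact (Metric.isBounded_closedBall).subset
          (vadd_smul_subset_closedBall_zero hKD _ (hpos i).le)
      obtain ⟨R, hR⟩ := hT.subset_closedBall 0
      refine ⟨max R (b + 1), le_max_right _ _, fun i hi => ?_⟩
      exact (Set.subset_biUnion_of_mem (u := B x) hi).trans
        (hR.trans (Metric.closedBall_subset_closedBall (le_max_left _ _)))
    by_cases hk : k ∈ U ∪ S
    · obtain ⟨R, hR1, hR2⟩ := hbd S x
      refine ⟨S, x, (b, R), hSU, Finset.mem_union.1 hk, rfl, hR1, hR2, S, ∅, by simp,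
        hScard.trans_le hFcard, by simp, hSdisj, hScov, by simp, by simp⟩
    · rw [Finset.mem_union, not_or] at hk
      obtain ⟨R, hR1, hR2⟩ := hbd S x
      obtain ⟨v, hv⟩ := exists_disjoint_closedBall hd hKD (hpos k).le R
      set x' := Function.update x k v with hx'
      have hx'S : ∀ i ∈ S, B x' i = B x i := by
        intro i hi
        refine hBcongr (Function.update_of_ne ?_ _ _)
        rintro rfl
        exact hk.2 hi
      have hx'k : B x' k = v +ᵥ lam k • K := by
        simp only [B, hx', Function.update_self]
      obtain ⟨R', hR1', hR2'⟩ := hbd (S ∪ {k}) x'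
      refine ⟨S ∪ {k}, x', (b, R'), ?_, Or.inr (by simp), rfl, hR1', hR2', S, {k}, rfl,
        hScard.trans_le hFcard, by simp, ?_, ?_, ?_, ?_⟩
      · rw [Finset.disjoint_union_left]
        exact ⟨hSU, Finset.disjoint_singleton_left.2 hk.1⟩
      · intro i hi
        rw [hx'S i hi]
        exact hSdisj i hi
      · rw [Set.iUnion₂_congr hx'S]
        exact hScov
      · intro i hi
        rw [Finset.mem_singleton.1 hi, hx'k]
        exact hv.mono_right (Metric.closedBall_subset_closedBall (by linarith))
      · intro i hi j hj
        rw [Finset.mem_singleton.1 hi, hx'k, hx'S j hj]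
        exact hv.mono_right (hR2 j hj)
  obtain ⟨st, τ, P, x, hst0, hτ, hP⟩ := exists_partition_of_step hcongr (-3, 0) hstep
  choose hfst hsnd hbound S L hPSL hScard hLcard hSdisj hScov hLdisj hLS using hP
  have hmono : Monotone fun k => (st k).2 :=
    monotone_nat_of_le_succ fun k => by linarith [hsnd k]
  have hgrow : ∀ k : ℕ, (k : ℝ) ≤ (st k).2 := by
    intro k
    induction k with
    | zero => rw [hst0]; simp
    | succ k ih =>
      push_cast
      linarith [hsnd k]
  have hcovball : ∀ k, Metric.closedBall 0 (C * ((st k).1 + 2)) ⊆ ⋃ i, B x i := by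
    intro k
    induction k with
    | zero =>
      rw [hst0, Metric.closedBall_eq_empty.2 (by norm_num; exact hC)]
      exact Set.empty_subset _
    | succ k ih =>
      rw [hfst]
      refine (hScov k).trans (Set.union_subset ih ?_)
      exact Set.iUnion₂_subset fun i _ => Set.subset_iUnion (B x) i
  refine ⟨x, ?_, ?_⟩
  · refine Set.eq_univ_of_forall fun y => ?_
    obtain ⟨k, hk⟩ := exists_nat_ge (‖y‖ / C)
    refine hcovball (k + 1) (mem_closedBall_zero_iff.2 ?_)
    rw [hfst]
    rw [div_le_iff₀ hC] at hk
    nlinarith [hgrow k]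
  · intro p
    by_cases hex : ∃ k, ∃ i ∈ P k, p ∈ B x i
    · set k := Nat.find hex with hk
      obtain ⟨i₀, hi₀P, hi₀⟩ := Nat.find_spec hex
      have hpball : p ∈ Metric.closedBall 0 (st (k + 1)).2 := hbound k i₀ hi₀P hi₀
      have hmem : ∀ i, p ∈ B x i → i ∈ S k ∨ i ∈ L k ∨ i ∈ S (k + 1) := by
        intro i hi
        have hiP : i ∈ P (τ i) := (hτ i _).1 rfl
        have hle : k ≤ τ i := Nat.find_min' hex ⟨i, hiP, hi⟩
        rw [hPSL, Finset.mem_union] at hiP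
        rcases hiP with hiS | hiL
        · rcases hle.eq_or_lt with h | h
          · rw [← h] at hiS
            exact Or.inl hiS
          · rcases (Nat.succ_le_of_lt h).eq_or_lt with h' | h'
            · rw [← h'] at hiS
              exact Or.inr (Or.inr hiS)
            · exfalso
              refine Set.disjoint_left.1 (hSdisj _ i hiS) hi
                (Metric.closedBall_subset_closedBall ?_ hpball)
              obtain ⟨n, hn⟩ : ∃ n, τ i = n + 1 := ⟨τ i - 1, by omega⟩
              rw [hn, hfst]
              exact hmono (by omega)
        · rcases hle.eq_or_lt with h | h
          · rw [← h] at hiL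
            exact Or.inr (Or.inl hiL)
          · exfalso
            exact Set.disjoint_left.1 (hLdisj _ i hiL) hi
              (Metric.closedBall_subset_closedBall (hmono h) hpball)
      obtain ⟨T, hTcard, hT⟩ : ∃ T : Finset ℕ, T.card ≤ 4 * d ∧ {i | p ∈ B x i} ⊆ T := by
        by_cases hL : ∃ i ∈ L k, p ∈ B x i
        · obtain ⟨i₁, hi₁L, hi₁⟩ := hL
          refine ⟨L k ∪ S (k + 1), (Finset.card_union_le _ _).trans ?_, fun i hi => ?_⟩
          · have h1 := hLcard k
            have h2 := hScard (k + 1)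
            omega
          · rcases hmem i hi with h | h | h
            · exact absurd hi (Set.disjoint_left.1 (hLS k i₁ hi₁L i h) hi₁)
            · exact Finset.mem_union_left _ h
            · exact Finset.mem_union_right _ h
        · refine ⟨S k ∪ S (k + 1), (Finset.card_union_le _ _).trans ?_, fun i hi => ?_⟩
          · have h1 := hScard k
            have h2 := hScard (k + 1)
            omega
          · rcases hmem i hi with h | h | h
            · exact Finset.mem_union_left _ h
            · exact absurd ⟨i, h, hi⟩ hL
            · exact Finset.mem_union_right _ h
      calc {i | p ∈ B x i}.encard ≤ (T : Set ℕ).encard := Set.encard_le_encard hT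
        _ = T.card := Set.encard_coe_eq_coe_finsetCard T
        _ ≤ _ := by exact_mod_cast hTcard
    · have hempty : {i | p ∈ B x i} = ∅ := by
        rw [Set.eq_empty_iff_forall_notMem]
        intro i hi
        exact hex ⟨τ i, i, (hτ i _).1 rfl, hi⟩
      change {i | p ∈ B x i}.encard ≤ _
      rw [hempty, Set.encard_empty]
      exact zero_le

end

end TranslativeCovering

theorem theorem1 (d : ℕ) (hd : 1 ≤ d) (K : ConvexBody (EuclideanSpace ℝ (Fin d)))
    (hK : (interior (K : Set (EuclideanSpace ℝ (Fin d)))).Nonempty)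
    (lam : ℕ → ℝ) (hpos : ∀ i, 0 < lam i) (hsum : ¬ Summable (fun i => lam i ^ d)) :
    (BddAbove (Set.range lam) → (∃ c : ℝ, c ≠ 0 ∧ MapClusterPt c atTop lam) →
      TranslativeCovering.PermitsCoveringOfDensity
        (fun i => lam i • (K : Set (EuclideanSpace ℝ (Fin d))))
        (TranslativeCovering.coveringDensity (K : Set (EuclideanSpace ℝ (Fin d))))) ∧
    (BddAbove (Set.range lam) → (∀ c : ℝ, MapClusterPt c atTop lam → c = 0) →
      TranslativeCovering.PermitsCoveringOfDensity
        (fun i => lam i • (K : Set (EuclideanSpace ℝ (Fin d)))) 1) ∧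
    (¬ BddAbove (Set.range lam) →
      TranslativeCovering.PermitsCoveringOfMultiplicity
        (fun i => lam i • (K : Set (EuclideanSpace ℝ (Fin d)))) (4 * d)) := by
  have hb : Bornology.IsBounded (K : Set (EuclideanSpace ℝ (Fin d))) := K.isCompact.isBounded
  refine ⟨fun hbdd hcl => ?_, fun hbdd hcl => ?_, fun hunb =>
    TranslativeCovering.permitsCoveringOfMultiplicity_of_unbounded hd K.convex K.isCompact hK hpos
      hunb⟩
  · obtain ⟨c, hc0, hc⟩ := hcl
    have hcpos : 0 < c := by
      by_contra hneg
      obtain ⟨i, hi⟩ := (hc.frequently (p := fun x => x < 0)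
        (Iio_mem_nhds (lt_of_le_of_ne (not_lt.1 hneg) hc0))).exists
      exact lt_asymm hi (hpos i)
    have h := (TranslativeCovering.hasCubeCoverings_of_mapClusterPt hd K.convex hb hK hpos hcpos
      hc).permitsCoveringOfDensity hd hb K.nonempty hpos hbdd ENNReal.toReal_nonneg
    rwa [ENNReal.ofReal_toReal (TranslativeCovering.coveringDensity_ne_top hd hb hK)] at h
  · have h := (TranslativeCovering.hasCubeCoverings_of_tendsto_zero K.convex hb hK hpos
      (TranslativeCovering.tendsto_zero_of_mapClusterPt hpos hbdd hcl)
      hsum).permitsCoveringOfDensity hd hb K.nonempty hpos hbdd zero_le_one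
    rwa [ENNReal.ofReal_one] at h
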